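/- **Setting.** Let $M$ be a compact connected (Hausdorff) affine manifold of dimension $n$, i.e. a manifold with a distinguished atlas whose transition maps are locally affine. Let $L\to M$ be an affine $\mathbb R$-bundle, i.e. a principal $\mathbb R$-bundle with local trivializations over an open cover $(U_i)$ of $M$ whose transition functions are $(x,y)\mapsto(x,y+\alpha_{ij}(x))$ with $\alpha_{ij}$ locally affine. A section of $L$ is called affine, convex, or smooth with positive definite Hessian if it is so (locally, in affine coordinates) in these trivializations; the difference of two sections is a function on $M$. Let $\phi_0$ be a Hessian metric in $L$, i.e. a smooth section of $L$ with positive definite Hessian; we call $(M,L,\phi_0)$ a compact Hessian manifold. **Dual manifold.** Let $\pi:\Omega\to M$ be the universal covering, with deck transformation group $\Pi$, let $K=\pi^*L$, and let $\Gamma(\Omega,K)$ be the space of affine sections of $K$, an $(n+1)$-dimensional affine space. For $q\in\Gamma(\Omega,K)$ and a section $\phi$ of $L$ put $\Phi_q=\pi^*\phi-q:\Omega\to\mathbb R$. Let $K^*$ be the set of those $q\in\Gamma(\Omega,K)$ for which $\pi^*\phi_0-q$ is bounded from below and proper, let $\Omega^*=K^*/\mathbb R$, where $c\in\mathbb R$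 acts by $q\mapsto q+c$, and let $M^*=\Omega^*/\Pi$, where $\gamma\in\Pi$ acts by $\gamma.q=\gamma\circ q\circ\gamma^{-1}$. Taking the linear part of $q$ in affine coordinates of $\Omega$ gives affine coordinates on $\Omega^*$, hence on $M^*$, and a measure on $M^*$ is absolutely continuous if it vanishes on sets which are Lebesgue null in these coordinates. All measures are Borel. **Monge–Ampère measure.** For a convex section $\phi$ of $L$, let $d\phi:\Omega\to\Omega^*$ be the multivalued map with $p\in d\phi(x)$ if and only if, for $q\in K^*$ over $p$, the function $\Phi_q$ attains its minimum over $\Omega$ at $x$. It is $\Pi$-equivariant. Let $T_\phi$ be its inverse, regarded as a partially defined map $M^*\to M$: it is defined at those $p\in M^*$ for which a lift of $p$ to $\Omega^*$ belongs to $d\phi(x)$ for exactly one $x\in\Omega$, and then $T_\phi(p)=\pi(x)$. For a probability measure $\nu$ on $M^*$ for which $T_\phi$ is defined $\nu$-almost everywhere and is $\nu$-measurable, put $\mathrm{MA}_\nu(\phi)=(T_\phi)_*\nu$. **Theorem 1.6.** Let $(M,L,\phi_0)$ be a compact Hessian manifold, let $\nu$ be an absolutely continuous probability measure of full support on $M^*$,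 let $\mu$ be a probability measure on $M$, and let $\lambda\in\mathbb R$. Then there is a convex section $\phi$ of $L$ such that $T_\phi$ is defined $\nu$-almost everywhere and is $\nu$-measurable, and $$\mathrm{MA}_\nu(\phi)=e^{-\lambda(\phi-\phi_0)}\,\mu .$$ -/

import Mathlib

open Set Filter Topology MeasureTheory
open scoped ContDiff

noncomputable section

namespace HessianKE

/-- The model space `ℝⁿ`. -/
abbrev E (n : ℕ) := EuclideanSpace ℝ (Fin n)

/-- `f` is, near `x`, the affine function `a · g + b` of the coordinates `g`, with linear part `a`. -/
def HasSlopeAt {n : ℕ} {X : Type*} [TopologicalSpace X] (g : X → E n) (f : X → ℝ) (x : X)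
    (a : E n) : Prop :=
  ∃ b : ℝ, ∀ᶠ y in 𝓝 x, f y = inner ℝ a (g y) + b

/-- `f` is affine near `x` in the coordinates `g`. -/
def IsAffineAt {n : ℕ} {X : Type*} [TopologicalSpace X] (g : X → E n) (f : X → ℝ) (x : X) : Prop :=
  ∃ a : E n, HasSlopeAt g f x a

/-- An affine manifold: the transition maps of the distinguished atlas are (locally) affine. -/
class IsAffineManifold (n : ℕ) (M : Type*) [TopologicalSpace M] [ChartedSpace (E n) M] : Prop where
  affine_transition : ∀ e ∈ atlas (E n) M, ∀ e' ∈ atlas (E n) M, ∀ z ∈ (e.symm.trans e').source,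
    ∃ A : E n →ᵃ[ℝ] E n, ∀ᶠ w in 𝓝 z, e' (e.symm w) = A w

/-- An affine `ℝ`-bundle `L → M`, given by local trivializations over an open cover `baseSet i`
whose transition functions are `(x, y) ↦ (x, y + transition i j x)`, from the `j`-th to the `i`-th
trivialization, with `transition i j` affine. As for Mathlib's `FiberBundleCore`, the fibre over `x`
is identified with `ℝ` by means of the preferred trivialization `indexAt x`. -/
structure AffineRBundle (n : ℕ) (M : Type*) [TopologicalSpace M] [ChartedSpace (E n) M]
    (ι : Type*) where
  baseSet : ι → Set M
  isOpen_baseSet : ∀ i, IsOpen (baseSet i)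
  indexAt : M → ι
  mem_baseSet_at : ∀ x, x ∈ baseSet (indexAt x)
  transition : ι → ι → M → ℝ
  affine_transition : ∀ i j, ∀ x ∈ baseSet i ∩ baseSet j,
    IsAffineAt (chartAt (E n) x) (transition i j) x
  cocycle : ∀ i j k, ∀ x ∈ baseSet i ∩ baseSet j ∩ baseSet k,
    transition i j x + transition j k x = transition i k x

section Sections

variable {n : ℕ} {M : Type*} [TopologicalSpace M] [ChartedSpace (E n) M] {ι : Type*}

/-- A section of `L` is a function `s : M → ℝ`, where `s x` is the value of the section in the fibre
over `x`, read in the trivialization `indexAt x`; so the difference of two sections is their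
pointwise difference. `L.rep i s` is the section `s` read in the `i`-th trivialization; it is
meaningful on `L.baseSet i`. -/
def AffineRBundle.rep (L : AffineRBundle n M ι) (i : ι) (s : M → ℝ) (x : M) : ℝ :=
  s x + L.transition i (L.indexAt x) x

/-- A convex section of `L`: in every trivialization it is locally a convex function of the affine
coordinates. -/
def AffineRBundle.IsConvexSection (L : AffineRBundle n M ι) (s : M → ℝ) : Prop :=
  ∀ i, ∀ x ∈ L.baseSet i, ∃ r > 0,
    Metric.ball (chartAt (E n) x x) r ⊆
      (chartAt (E n) x).target ∩ (chartAt (E n) x).symm ⁻¹' L.baseSet i ∧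
    ConvexOn ℝ (Metric.ball (chartAt (E n) x x) r) (L.rep i s ∘ (chartAt (E n) x).symm)

/-- A Hessian metric in (the Kähler class given by) `L`: a smooth section of `L` whose Hessian in
affine coordinates is positive definite. -/
def AffineRBundle.IsHessianMetric (L : AffineRBundle n M ι) (s : M → ℝ) : Prop :=
  ∀ i, ∀ x ∈ L.baseSet i,
    ContDiffAt ℝ ∞ (L.rep i s ∘ (chartAt (E n) x).symm) (chartAt (E n) x x) ∧
    ∀ v : E n, v ≠ 0 →
      0 < iteratedFDeriv ℝ 2 (L.rep i s ∘ (chartAt (E n) x).symm) (chartAt (E n) x x) ![v, v]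

end Sections

section Dual

variable {n : ℕ} {M : Type*} [TopologicalSpace M] [ChartedSpace (E n) M] {ι : Type*}
  {Ω : Type*} [TopologicalSpace Ω]

/-- The group `Π` of deck transformations of `π : Ω → M`. -/
def Deck (π : Ω → M) : Subgroup (Ω ≃ₜ Ω) where
  carrier := {γ | ∀ x, π (γ x) = π x}
  mul_mem' := by
    intro a b ha hb x
    exact (ha (b x)).trans (hb x)
  one_mem' := fun _ => rfl
  inv_mem' := by
    intro a ha x
    have h := ha (a⁻¹ x)
    rw [show a (a⁻¹ x) = x from a.apply_symm_apply x] at h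
    exact h.symm

/-- The affine coordinates on the covering space `Ω` near `x`, pulled back from `M`. -/
def coverCoord (n : ℕ) [ChartedSpace (E n) M] (π : Ω → M) (x : Ω) : Ω → E n :=
  fun y => chartAt (E n) (π x) (π y)

/-- The pullback `K → Ω` of `L` has the trivializations of `L` over the open sets
`π ⁻¹' L.baseSet i`. A section of `K` is a function `q : Ω → ℝ`, its value at `y` being read in the
trivialization `L.indexAt (π y)`; `coverRep L π i q` is `q` read in the `i`-th trivialization.
The pullback to `K` of a section `φ` of `L` is `φ ∘ π`. -/
def coverRep (L : AffineRBundle n M ι) (π : Ω → M) (i : ι) (q : Ω → ℝ) (y : Ω) : ℝ :=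
  q y + L.transition i (L.indexAt (π y)) (π y)

/-- `q ∈ Γ(Ω, K)`: the section `q` of `K` is affine. -/
def IsAffineCoverSection (L : AffineRBundle n M ι) (π : Ω → M) (q : Ω → ℝ) : Prop :=
  ∀ i, ∀ x, π x ∈ L.baseSet i → IsAffineAt (coverCoord n π x) (coverRep L π i q) x

/-- `K*`: the affine sections `q` of `K` for which `Φ_q = π^* φ₀ - q` is bounded from below and
proper. It carries the topology of pointwise convergence, which on the finite dimensional affine
space `Γ(Ω, K)` is the usual one. -/
def KStar (L : AffineRBundle n M ι) (φ₀ : M → ℝ) (π : Ω → M) : Type _ :=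
  {q : Ω → ℝ // IsAffineCoverSection L π q ∧ BddBelow (range fun x => φ₀ (π x) - q x) ∧
    IsProperMap fun x => φ₀ (π x) - q x}

variable {L : AffineRBundle n M ι} {φ₀ : M → ℝ} {π : Ω → M}

instance : TopologicalSpace (KStar L φ₀ π) := inferInstanceAs (TopologicalSpace (Subtype _))

/-- The action of `ℝ` on `K*` by `q ↦ q + c`. -/
instance : AddAction ℝ (KStar L φ₀ π) where
  vadd c q := ⟨fun x => q.1 x + c, by
    obtain ⟨q, hq, ⟨m, hm⟩, hp⟩ := q
    refine ⟨?_, ⟨m - c, ?_⟩, ?_⟩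
    · intro i x hx
      obtain ⟨a, b, h⟩ := hq i x hx
      refine ⟨a, b + c, h.mono fun y hy => ?_⟩
      simp only [coverRep] at hy ⊢
      linarith
    · rintro _ ⟨x, rfl⟩
      have := hm ⟨x, rfl⟩
      dsimp only at this ⊢
      linarith
    · have h := (Homeomorph.addRight (-c)).isProperMap.comp hp
      refine (congrArg IsProperMap (funext fun x => ?_)).mp h
      simp only [Function.comp, Homeomorph.coe_addRight]
      ring⟩
  zero_vadd q := Subtype.ext (funext fun x => add_zero (q.1 x))
  add_vadd c d q := Subtype.ext (funext fun x => by
    change q.1 x + (c + d) = q.1 x + d + c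
    ring)

/-- The action of `Π` on `K*` by `γ.q = γ ∘ q ∘ γ⁻¹`; as `γ` acts on the fibres of `K` through the
identity of the fibres of `L`, this reads `q ∘ γ⁻¹`. -/
instance : MulAction (Deck π) (KStar L φ₀ π) where
  smul γ q := ⟨fun x => q.1 ((γ⁻¹ : Deck π).1 x), by
    obtain ⟨q, hq, ⟨m, hm⟩, hp⟩ := q
    have hγ : ∀ x, π ((γ⁻¹ : Deck π).1 x) = π x := (γ⁻¹ : Deck π).2
    refine ⟨?_, ⟨m, ?_⟩, ?_⟩
    · intro i x hx
      obtain ⟨a, b, h⟩ := hq i ((γ⁻¹ : Deck π).1 x) (by rwa [hγ])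
      refine ⟨a, b, ?_⟩
      filter_upwards [((γ⁻¹ : Deck π).1.continuous.tendsto x).eventually h] with y hy
      simpa only [coverRep, coverCoord, hγ] using hy
    · rintro _ ⟨x, rfl⟩
      have := hm ⟨(γ⁻¹ : Deck π).1 x, rfl⟩
      simpa only [hγ] using this
    · have h := hp.comp (γ⁻¹ : Deck π).1.isProperMap
      refine (congrArg IsProperMap (funext fun x => ?_)).mp h
      simp only [Function.comp, hγ]⟩
  one_smul q := Subtype.ext (funext fun x => by
    change q.1 ((1⁻¹ : Deck π).1 x) = q.1 x
    rw [inv_one]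
    rfl)
  mul_smul γ δ q := Subtype.ext (funext fun x => by
    change q.1 (((γ * δ)⁻¹ : Deck π).1 x) = q.1 ((δ⁻¹ : Deck π).1 ((γ⁻¹ : Deck π).1 x))
    rw [mul_inv_rev]
    rfl)

theorem smul_vadd_comm (γ : Deck π) (c : ℝ) (q : KStar L φ₀ π) : γ • (c +ᵥ q) = c +ᵥ (γ • q) :=
  rfl

variable (L φ₀ π)

/-- `Ω* = K* / ℝ`, with the quotient topology. -/
def OmegaStar : Type _ := AddAction.orbitRel.Quotient ℝ (KStar L φ₀ π)

instance : TopologicalSpace (OmegaStar L φ₀ π) :=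
  inferInstanceAs (TopologicalSpace (Quotient (AddAction.orbitRel ℝ (KStar L φ₀ π))))

/-- The quotient map `K* → Ω*`. -/
def toOmegaStar (q : KStar L φ₀ π) : OmegaStar L φ₀ π :=
  Quotient.mk (AddAction.orbitRel ℝ (KStar L φ₀ π)) q

/-- The action of `Π` on `Ω*` induced from the one on `K*`. -/
instance : MulAction (Deck π) (OmegaStar L φ₀ π) where
  smul γ p := Quotient.map (sa := AddAction.orbitRel ℝ (KStar L φ₀ π))
    (sb := AddAction.orbitRel ℝ (KStar L φ₀ π)) (fun q => γ • q) (by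
      rintro _ q ⟨c, rfl⟩
      exact ⟨c, (smul_vadd_comm γ c q).symm⟩) p
  one_smul p := by
    induction p using Quotient.inductionOn with
    | h q => exact congrArg (toOmegaStar L φ₀ π) (one_smul (Deck π) q)
  mul_smul γ δ p := by
    induction p using Quotient.inductionOn with
    | h q => exact congrArg (toOmegaStar L φ₀ π) (mul_smul γ δ q)

/-- The dual manifold `M* = Ω* / Π`, with the quotient topology and its Borel `σ`-algebra. -/
def MStar : Type _ := MulAction.orbitRel.Quotient (Deck π) (OmegaStar L φ₀ π)

instance : TopologicalSpace (MStar L φ₀ π) :=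
  inferInstanceAs (TopologicalSpace (Quotient (MulAction.orbitRel (Deck π) (OmegaStar L φ₀ π))))

instance : MeasurableSpace (MStar L φ₀ π) := borel _

instance : BorelSpace (MStar L φ₀ π) := ⟨rfl⟩

/-- The quotient map `Ω* → M*`. -/
def toMStar (p : OmegaStar L φ₀ π) : MStar L φ₀ π :=
  Quotient.mk (MulAction.orbitRel (Deck π) (OmegaStar L φ₀ π)) p

variable {L φ₀ π}

/-- The linear parts of the affine sections `q ∈ K*` lying over `N ⊆ M*`, in the trivialization of
`K` and the affine coordinates at `x ∈ Ω`. As `q ↦` (linear part of `q`) induces an affine embedding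
of `Ω*` into `(ℝⁿ)* ≅ ℝⁿ`, this is the preimage of `N` in `Ω*`, written in affine coordinates
of `Ω*`. -/
def dualCoordSet (N : Set (MStar L φ₀ π)) (x : Ω) : Set (E n) :=
  {a | ∃ q : KStar L φ₀ π, toMStar L φ₀ π (toOmegaStar L φ₀ π q) ∈ N ∧
    HasSlopeAt (coverCoord n π x) (coverRep L π (L.indexAt (π x)) q.1) x a}

/-- `ν` is absolutely continuous: it vanishes on the sets which are Lebesgue null in the affine
coordinates of `M*`. -/
def IsAbsCont (ν : Measure (MStar L φ₀ π)) : Prop :=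
  ∀ N : Set (MStar L φ₀ π), (∀ x : Ω, volume (dualCoordSet N x) = 0) → ν N = 0

/-- The (multivalued) differential `dφ : Ω → Ω*` of a convex section `φ` of `L`: `p ∈ dφ(x)` when
an affine section `q` over `p` supports `π^* φ` at `x`, that is, when `Φ_q = π^* φ - q` has its
minimum at `x`. -/
def differential (φ : M → ℝ) (x : Ω) : Set (OmegaStar L φ₀ π) :=
  {p | ∃ q : KStar L φ₀ π, toOmegaStar L φ₀ π q = p ∧ ∀ z, φ (π x) - q.1 x ≤ φ (π z) - q.1 z}

/-- The inverse of the multivalued differential `dφ` is single valued at `p ∈ M*`, with value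
`y ∈ M`: there are a lift of `p` to `Ω*` and a point `x` over `y` such that `x` is the only point of
`Ω` whose differential contains the lift. -/
def IsInverseAt (φ : M → ℝ) (p : MStar L φ₀ π) (y : M) : Prop :=
  ∃ p' : OmegaStar L φ₀ π, toMStar L φ₀ π p' = p ∧
    ∃ x : Ω, π x = y ∧ ∀ z : Ω, p' ∈ differential φ z ↔ z = x

theorem smul_mem_differential (φ : M → ℝ) (γ : Deck π) (p : OmegaStar L φ₀ π) (x : Ω)
    (h : p ∈ differential φ x) : γ • p ∈ differential φ (γ.1 x) := by
  obtain ⟨q, rfl, hq⟩ := h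
  refine ⟨γ • q, rfl, fun z => ?_⟩
  have h1 : (γ • q).1 (γ.1 x) = q.1 x := congrArg q.1 (γ.1.symm_apply_apply x)
  have h2 : (γ • q).1 z = q.1 ((γ⁻¹ : Deck π).1 z) := rfl
  have h3 := hq ((γ⁻¹ : Deck π).1 z)
  rw [(γ⁻¹ : Deck π).2 z] at h3
  rw [h1, h2, γ.2 x]
  exact h3

/-- The value of the inverse is well defined. -/
theorem IsInverseAt.unique {φ : M → ℝ} {p : MStar L φ₀ π} {y y' : M} (h : IsInverseAt φ p y)
    (h' : IsInverseAt φ p y') : y = y' := by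
  obtain ⟨p₁, rfl, x, rfl, hx⟩ := h
  obtain ⟨p₂, h12, x', rfl, hx'⟩ := h'
  obtain ⟨γ, rfl⟩ : ∃ γ : Deck π, γ • p₁ = p₂ := Quotient.exact h12
  have := (hx' (γ.1 x)).1 (smul_mem_differential φ γ p₁ x ((hx x).2 rfl))
  rw [← this, γ.2 x]

open Classical in
/-- The map `T_φ : M* → M`, the inverse of `dφ` at all points where that is single valued, extended
by a constant elsewhere. -/
def T [Nonempty M] (φ : M → ℝ) (p : MStar L φ₀ π) : M :=
  if h : ∃ y, IsInverseAt φ p y then h.choose else Classical.arbitrary M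

/-- The `ν`-Monge–Ampère measure `MA_ν(φ) = (T_φ)_* ν`. -/
def MA [MeasurableSpace M] [Nonempty M] (ν : Measure (MStar L φ₀ π)) (φ : M → ℝ) : Measure M :=
  ν.map (T φ)

end Dual

end HessianKE

end

open Set Filter Topology MeasureTheory
open scoped ContDiff BoundedContinuousFunction

noncomputable section

namespace HessianKE

/-! ### Convexity from local midpoint convexity in one variable -/

/-- A continuous function on `[0, 1]` which at every interior point lies below its symmetric
averages at small scales lies below its chord. -/
theorem le_chord_of_local_midpoint {f : ℝ → ℝ} (hf : ContinuousOn f (Icc 0 1))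
    (hm : ∀ t ∈ Ioo (0 : ℝ) 1, ∀ᶠ h in 𝓝 (0 : ℝ), 2 * f t ≤ f (t + h) + f (t - h))
    {t : ℝ} (ht : t ∈ Icc (0 : ℝ) 1) : f t ≤ (1 - t) * f 0 + t * f 1 := by
  set g : ℝ → ℝ := fun s => f s - ((1 - s) * f 0 + s * f 1) with hg
  have hgc : ContinuousOn g (Icc 0 1) := by
    apply hf.sub
    fun_prop
  by_contra! hlt
  obtain ⟨s, hs, hmax⟩ := isCompact_Icc.exists_isMaxOn ⟨t, ht⟩ hgc
  have hgt : 0 < g t := by simp only [hg]; linarith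
  have hgs : 0 < g s := hgt.trans_le (hmax ht)
  have hcl : IsCompact (Icc (0 : ℝ) 1 ∩ g ⁻¹' {g s}) :=
    isCompact_Icc.of_isClosed_subset
      (hgc.preimage_isClosed_of_isClosed isClosed_Icc isClosed_singleton) inter_subset_left
  obtain ⟨a, ⟨ha, hga⟩, hmin⟩ := hcl.exists_isLeast ⟨s, hs, rfl⟩
  simp only [mem_preimage, mem_singleton_iff] at hga
  have ha0 : a ≠ 0 := by
    rintro rfl
    simp only [hg] at hga hgs
    linarith
  have ha1 : a ≠ 1 := by
    rintro rfl
    simp only [hg] at hga hgs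
    linarith
  have haI : a ∈ Ioo (0 : ℝ) 1 :=
    ⟨lt_of_le_of_ne ha.1 (Ne.symm ha0), lt_of_le_of_ne ha.2 ha1⟩
  have h1 : ∀ᶠ h in 𝓝 (0 : ℝ), a + h ∈ Icc (0 : ℝ) 1 := by
    have : Tendsto (fun h : ℝ => a + h) (𝓝 0) (𝓝 a) :=
      Continuous.tendsto' (by fun_prop) _ _ (by simp)
    exact this.eventually (Icc_mem_nhds haI.1 haI.2)
  have h2 : ∀ᶠ h in 𝓝 (0 : ℝ), a - h ∈ Icc (0 : ℝ) 1 := by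
    have : Tendsto (fun h : ℝ => a - h) (𝓝 0) (𝓝 a) :=
      Continuous.tendsto' (by fun_prop) _ _ (by simp)
    exact this.eventually (Icc_mem_nhds haI.1 haI.2)
  obtain ⟨h, ⟨hh, hp, hn⟩, hpos⟩ :=
    (((hm a haI).and (h1.and h2)).filter_mono nhdsWithin_le_nhds
      |>.and (self_mem_nhdsWithin : Ioi (0 : ℝ) ∈ 𝓝[>] 0)).exists
  have hpos : 0 < h := hpos
  have e1 : g (a + h) ≤ g s := hmax hp
  have e2 : g (a - h) < g s := by
    refine lt_of_le_of_ne (hmax hn) fun he => ?_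
    have := hmin ⟨hn, he⟩
    linarith
  simp only [hg] at e1 e2 hga hgs
  linarith

/-- A function with positive second derivative at `z` in the direction `v` lies below its symmetric
averages in this direction at small scales. -/
theorem local_midpoint_of_second_deriv_pos {E : Type*} [NormedAddCommGroup E] [NormedSpace ℝ E]
    {F : E → ℝ} {z v : E} (hF : ContDiffAt ℝ 2 F z)
    (hpos : 0 < iteratedFDeriv ℝ 2 F z ![v, v]) :
    ∀ᶠ h in 𝓝 (0 : ℝ), 2 * F z ≤ F (z + h • v) + F (z - h • v) := by
  have hline : ∀ s : ℝ, Tendsto (fun h : ℝ => z + (s * h) • v) (𝓝 0) (𝓝 z) := fun s =>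
    Continuous.tendsto' (by fun_prop) _ _ (by simp)
  have hd : ∀ᶠ y in 𝓝 z, DifferentiableAt ℝ F y :=
    (hF.eventually (by simp)).mono fun y hy => hy.differentiableAt (by simp)
  set k : ℝ → ℝ := fun h => F (z + ((1 : ℝ) * h) • v) + F (z + ((-1 : ℝ) * h) • v) with hk
  have hder : ∀ s : ℝ, ∀ h : ℝ, DifferentiableAt ℝ F (z + (s * h) • v) →
      HasDerivAt (fun h : ℝ => F (z + (s * h) • v)) (s * fderiv ℝ F (z + (s * h) • v) v) h := by
    intro s h hh
    have h1 : HasDerivAt (fun h : ℝ => z + (s * h) • v) (s • v) h := by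
      have := (((hasDerivAt_id h).const_mul s).smul_const v).const_add z
      simpa using this
    exact (hh.hasFDerivAt.comp_hasDerivAt h h1).congr_deriv (by simp)
  have hk1 : deriv k =ᶠ[𝓝 0] fun h => fderiv ℝ F (z + ((1 : ℝ) * h) • v) v
      - fderiv ℝ F (z + ((-1 : ℝ) * h) • v) v := by
    filter_upwards [(hline 1).eventually hd, (hline (-1)).eventually hd] with h h1 h2
    exact (((hder 1 h h1).add (hder (-1) h h2)).congr_deriv (by ring)).deriv
  have hdd : DifferentiableAt ℝ (fderiv ℝ F) z :=
    (hF.fderiv_right (m := 1) (by norm_num)).differentiableAt (by simp)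
  have hder2 : ∀ s : ℝ, HasDerivAt (fun h : ℝ => fderiv ℝ F (z + (s * h) • v) v)
      (s * fderiv ℝ (fderiv ℝ F) z v v) 0 := by
    intro s
    have h1 : HasDerivAt (fun h : ℝ => z + (s * h) • v) (s • v) 0 := by
      have := (((hasDerivAt_id (0 : ℝ)).const_mul s).smul_const v).const_add z
      simpa using this
    have h2 : HasFDerivAt (fun y => fderiv ℝ F y v)
        ((ContinuousLinearMap.apply ℝ ℝ v).comp (fderiv ℝ (fderiv ℝ F) z)) (z + (s * 0) • v) := by
      rw [mul_zero, zero_smul, add_zero]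
      exact (ContinuousLinearMap.apply ℝ ℝ v).hasFDerivAt.comp z hdd.hasFDerivAt
    refine (h2.comp_hasDerivAt (0 : ℝ) h1).congr_deriv
      (g' := s * fderiv ℝ (fderiv ℝ F) z v v) ?_
    simp
  have hk2 : deriv (deriv k) 0 = 2 * fderiv ℝ (fderiv ℝ F) z v v := by
    rw [hk1.deriv_eq]
    exact (((hder2 1).sub (hder2 (-1))).congr_deriv (by ring)).deriv
  have hk0 : deriv k 0 = 0 := by
    rw [hk1.eq_of_nhds]
    simp
  have hkc : ContinuousAt k 0 := by
    have hz : ContinuousAt F z := hF.continuousAt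
    have : ∀ s : ℝ, ContinuousAt (fun h : ℝ => F (z + (s * h) • v)) 0 := fun s =>
      ContinuousAt.comp (g := F) (f := fun h : ℝ => z + (s * h) • v) (by simpa using hz)
        (by fun_prop)
    exact (this 1).add (this (-1))
  rw [iteratedFDeriv_two_apply] at hpos
  have hmin : IsLocalMin k 0 := isLocalMin_of_deriv_deriv_pos (by
    rw [hk2]
    simpa using hpos) hk0 hkc
  filter_upwards [hmin] with h hh
  simp only [hk, zero_smul, add_zero, sub_zero, one_mul, neg_mul, neg_smul, ← sub_eq_add_neg] at hh
  linarith

/-! ### Functions with compact sublevel sets -/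

/-- `f` is continuous with compact sublevel sets. -/
structure IsCoercive {X : Type*} [TopologicalSpace X] (f : X → ℝ) : Prop where
  continuous : Continuous f
  isCompact_le : ∀ R, IsCompact {x | f x ≤ R}

section Coercive

theorem iInf_eq_of_forall_le {X : Type*} {f : X → ℝ} {x : X} (hx : ∀ y, f x ≤ f y) : ⨅ y, f y = f x :=
  have : Nonempty X := ⟨x⟩
  le_antisymm (ciInf_le ⟨f x, by rintro _ ⟨y, rfl⟩; exact hx y⟩ x) (le_ciInf hx)

variable {X : Type*} [TopologicalSpace X] {f v : X → ℝ} {B : ℝ}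

theorem IsCoercive.of_isProperMap (hf : IsProperMap f) (hb : BddBelow (range f)) :
    IsCoercive f := by
  obtain ⟨m, hm⟩ := hb
  refine ⟨hf.continuous, fun R => ?_⟩
  have : {x | f x ≤ R} = f ⁻¹' Icc m R := by
    ext x
    exact ⟨fun h => ⟨hm ⟨x, rfl⟩, h⟩, fun h => h.2⟩
  rw [this]
  exact hf.isCompact_preimage isCompact_Icc

theorem IsCoercive.add_bounded (hf : IsCoercive f) (hv : Continuous v) (hB : ∀ x, |v x| ≤ B) :
    IsCoercive fun x => f x + v x := by
  refine ⟨hf.continuous.add hv, fun R => ?_⟩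
  refine (hf.isCompact_le (R + B)).of_isClosed_subset
    (isClosed_le (hf.continuous.add hv) continuous_const) fun x hx => ?_
  have := abs_le.1 (hB x)
  simp only [mem_ofPred_eq] at hx ⊢
  linarith

theorem IsCoercive.exists_min [Nonempty X] (hf : IsCoercive f) : ∃ x, ∀ y, f x ≤ f y := by
  obtain ⟨x₀⟩ := ‹Nonempty X›
  obtain ⟨x, -, hmin⟩ := (hf.isCompact_le (f x₀)).exists_isMinOn ⟨x₀, le_refl (f x₀)⟩
    hf.continuous.continuousOn
  refine ⟨x, fun y => ?_⟩
  by_cases hy : f y ≤ f x₀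
  · exact hmin hy
  · exact (hmin (show f x₀ ≤ f x₀ from le_rfl)).trans (not_le.1 hy).le

theorem IsCoercive.bddBelow [Nonempty X] (hf : IsCoercive f) : BddBelow (range f) := by
  obtain ⟨x, hx⟩ := hf.exists_min
  exact ⟨f x, by rintro _ ⟨y, rfl⟩; exact hx y⟩

theorem IsCoercive.iInf_le [Nonempty X] (hf : IsCoercive f) (x : X) : ⨅ y, f y ≤ f x :=
  ciInf_le hf.bddBelow x

theorem IsCoercive.exists_eq_iInf [Nonempty X] (hf : IsCoercive f) : ∃ x, f x = ⨅ y, f y := by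
  obtain ⟨x, hx⟩ := hf.exists_min
  exact ⟨x, le_antisymm (le_ciInf hx) (hf.iInf_le x)⟩

/-- Almost minimizers of a coercive function with a unique minimizer are close to it. -/
theorem IsCoercive.exists_lt_of_unique_min (hf : IsCoercive f) {x : X}
    (hx : ∀ z, (∀ y, f z ≤ f y) ↔ z = x) {W : Set X} (hW : IsOpen W) (hxW : x ∈ W) :
    ∃ ε > 0, ∀ y, f y < f x + ε → y ∈ W := by
  have hmin : ∀ y, f x ≤ f y := (hx x).2 rfl
  have hc : IsCompact ({y | f y ≤ f x + 1} \ W) := (hf.isCompact_le _).diff hW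
  rcases ({y | f y ≤ f x + 1} \ W).eq_empty_or_nonempty with he | hne
  · refine ⟨1, one_pos, fun y hy => ?_⟩
    by_contra hyW
    exact he.subset ⟨hy.le, hyW⟩
  · obtain ⟨z, hz, hzmin⟩ := hc.exists_isMinOn hne hf.continuous.continuousOn
    have hlt : f x < f z := by
      refine lt_of_le_of_ne (hmin z) fun he => hz.2 ?_
      rwa [(hx z).1 fun y => he ▸ hmin y]
    refine ⟨min 1 (f z - f x), lt_min one_pos (sub_pos.2 hlt), fun y hy => ?_⟩
    by_contra hyW
    have h1 := min_le_left 1 (f z - f x)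
    have h2 := min_le_right 1 (f z - f x)
    have : f z ≤ f y := hzmin ⟨(by simp only [mem_ofPred_eq]; linarith), hyW⟩
    linarith

/-- The right derivative of the minimum value `⨅ (f + t v)` at `t = 0` is the value of `v` at the
minimizer of `f`, if that is unique. -/
theorem IsCoercive.tendsto_iInf_div (hf : IsCoercive f) {x : X}
    (hx : ∀ z, (∀ y, f z ≤ f y) ↔ z = x) (hv : Continuous v) (hB : ∀ y, |v y| ≤ B) :
    Tendsto (fun t : ℝ => ((⨅ y, (f y + t * v y)) - ⨅ y, f y) / t) (𝓝[>] 0) (𝓝 (v x)) := by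
  have : Nonempty X := ⟨x⟩
  have hmin : ∀ y, f x ≤ f y := (hx x).2 rfl
  rw [iInf_eq_of_forall_le hmin]
  have hB0 : 0 ≤ B := (abs_nonneg _).trans (hB x)
  have hco : ∀ t : ℝ, IsCoercive fun y => f y + t * v y := fun t =>
    hf.add_bounded (hv.const_mul t) (B := |t| * B) fun y => by
      rw [abs_mul]
      exact mul_le_mul_of_nonneg_left (hB y) (abs_nonneg t)
  rw [Metric.tendsto_nhds]
  intro ε hε
  obtain ⟨δ, hδ, hδW⟩ := hf.exists_lt_of_unique_min hx
    (W := v ⁻¹' Metric.ball (v x) ε) (Metric.isOpen_ball.preimage hv) (by simpa using hε)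
  have hsmall : ∀ᶠ t in 𝓝[>] (0 : ℝ), t < δ / (2 * B + 1) :=
    nhdsWithin_le_nhds (Iio_mem_nhds (by positivity))
  filter_upwards [hsmall, self_mem_nhdsWithin] with t ht ht0
  have ht0 : 0 < t := ht0
  obtain ⟨z, hz⟩ := (hco t).exists_eq_iInf
  have hle := (hco t).iInf_le x
  rw [← hz] at hle ⊢
  have b1 := abs_le.1 (hB x)
  have b2 := abs_le.1 (hB z)
  rw [lt_div_iff₀ (by positivity)] at ht
  have hzW : z ∈ v ⁻¹' Metric.ball (v x) ε := hδW z (by nlinarith)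
  simp only [mem_preimage, Metric.mem_ball, Real.dist_eq] at hzW
  have hup : (f z + t * v z - f x) / t ≤ v x := by
    rw [div_le_iff₀ ht0]
    linarith
  have hlo : v z ≤ (f z + t * v z - f x) / t := by
    rw [le_div_iff₀ ht0]
    have := hmin z
    linarith
  rw [Real.dist_eq, abs_lt]
  have := (abs_lt.1 hzW)
  constructor <;> linarith

end Coercive

/-! ### Almost everywhere uniqueness of maximizers -/

section Unique

variable {V : Type*} [NormedAddCommGroup V] [InnerProductSpace ℝ V] [FiniteDimensional ℝ V]
  [MeasurableSpace V] [BorelSpace V]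

/-- For almost every `a` the function `⟪a, D⟫ - Ψ` has at most one maximizer on a compact set. -/
theorem volume_nonunique_compact {X : Type*} [TopologicalSpace X] {D : X → V} {Ψ : X → ℝ}
    (hD : Continuous D) (hinj : Function.Injective D) (hΨ : Continuous Ψ) {K : Set X}
    (hK : IsCompact K) :
    volume {a : V | ∃ y ∈ K, ∃ y' ∈ K, y ≠ y' ∧ (∀ z ∈ K, inner ℝ a (D z) - Ψ z ≤
      inner ℝ a (D y) - Ψ y) ∧ (∀ z ∈ K, inner ℝ a (D z) - Ψ z ≤ inner ℝ a (D y') - Ψ y')} = 0 := by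
  rcases K.eq_empty_or_nonempty with rfl | hne
  · simp
  have hcont : ∀ a : V, Continuous fun z => inner ℝ a (D z) - Ψ z := fun a => by fun_prop
  choose x hxK hxmax using fun a : V => hK.exists_isMaxOn hne (hcont a).continuousOn
  set h : V → ℝ := fun a => inner ℝ a (D (x a)) - Ψ (x a) with hh
  have hle : ∀ a, ∀ z ∈ K, inner ℝ a (D z) - Ψ z ≤ h a := fun a z hz => hxmax a hz
  obtain ⟨C, hC⟩ := (hK.image hD).isBounded.exists_norm_le
  have hC0 : 0 ≤ C := by
    obtain ⟨z, hz⟩ := hne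
    exact (norm_nonneg _).trans (hC _ ⟨z, hz, rfl⟩)
  have key : ∀ a b, h a - h b ≤ C * ‖a - b‖ := by
    intro a b
    have h1 := hle b (x a) (hxK a)
    have h2 : inner ℝ (a - b) (D (x a)) ≤ ‖a - b‖ * C :=
      (real_inner_le_norm _ _).trans
        (mul_le_mul_of_nonneg_left (hC _ ⟨_, hxK a, rfl⟩) (norm_nonneg _))
    rw [inner_sub_left] at h2
    simp only [hh] at h1 ⊢
    linarith
  have hlip : LipschitzWith C.toNNReal h := by
    apply LipschitzWith.of_dist_le_mul
    intro a b
    rw [Real.dist_eq, dist_eq_norm, Real.coe_toNNReal C hC0, abs_le]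
    have h1 := key a b
    have h2 := key b a
    rw [norm_sub_rev b a] at h2
    constructor <;> linarith
  refine measure_mono_null ?_ (hlip.ae_differentiableAt (μ := volume))
  rintro a ⟨y, hy, y', hy', hne', hmax, hmax'⟩ (hdiff : DifferentiableAt ℝ h a)
  have grad : ∀ z ∈ K, (∀ w ∈ K, inner ℝ a (D w) - Ψ w ≤ inner ℝ a (D z) - Ψ z) →
      fderiv ℝ h a = innerSL ℝ (D z) := by
    intro z hz hzmax
    have hmin : IsLocalMin (fun b => h b - innerSL ℝ (D z) b) a := by
      refine Filter.Eventually.of_forall fun b => ?_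
      have h1 := hle b z hz
      have h2 := hzmax (x a) (hxK a)
      simp only [innerSL_apply_apply, real_inner_comm _ (D z)]
      simp only [hh] at h1 ⊢
      linarith
    have := hmin.hasFDerivAt_eq_zero
      (hdiff.hasFDerivAt.sub (innerSL ℝ (D z)).hasFDerivAt)
    exact sub_eq_zero.1 this
  have e := (grad y hy hmax).symm.trans (grad y' hy' hmax')
  apply hne'
  apply hinj
  refine ext_inner_right ℝ fun w => ?_
  simpa using congrArg (fun f => f w) e

/-- For almost every `a` the function `Ψ - ⟪a, D⟫` has at most one minimizer. -/
theorem volume_nonunique {X : Type*} [TopologicalSpace X] {D : X → V} {Ψ : X → ℝ}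
    (hD : Continuous D) (hinj : Function.Injective D) (hΨ : IsCoercive Ψ) :
    volume {a : V | ∃ y y', y ≠ y' ∧ (∀ z, Ψ y - inner ℝ a (D y) ≤ Ψ z - inner ℝ a (D z)) ∧
      (∀ z, Ψ y' - inner ℝ a (D y') ≤ Ψ z - inner ℝ a (D z))} = 0 := by
  refine measure_mono_null (t := ⋃ k : ℕ, _) ?_ (measure_iUnion_null fun k : ℕ =>
    volume_nonunique_compact hD hinj hΨ.continuous (hΨ.isCompact_le k))
  rintro a ⟨y, y', hne, h1, h2⟩
  obtain ⟨k, hk⟩ := exists_nat_ge (max (Ψ y) (Ψ y'))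
  refine mem_iUnion.2 ⟨k, y, (le_max_left _ _).trans hk, y', (le_max_right _ _).trans hk, hne,
    fun z _ => ?_, fun z _ => ?_⟩
  · linarith [h1 z]
  · linarith [h2 z]

end Unique

/-! ### Affine functions and the developing map -/

theorem eq_zero_of_eventually_inner_eq {n : ℕ} {a w : E n} {c : ℝ}
    (h : ∀ᶠ z in 𝓝 w, inner ℝ a z = c) : a = 0 := by
  have h1 : HasFDerivAt (fun z => innerSL ℝ a z) (innerSL ℝ a) w := (innerSL ℝ a).hasFDerivAt
  have h2 : HasFDerivAt (fun z => innerSL ℝ a z) (0 : E n →L[ℝ] ℝ) w :=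
    (hasFDerivAt_const c w).congr_of_eventuallyEq (h.mono fun z hz => by simpa using hz)
  have h3 := congrArg (fun f => f a) (h1.unique h2)
  simpa using h3

section Affine

variable {n : ℕ} {X : Type*} [TopologicalSpace X] {g : X → E n} {f f' : X → ℝ} {x : X} {a a' : E n}

theorem HasSlopeAt.add (h : HasSlopeAt g f x a) (h' : HasSlopeAt g f' x a') :
    HasSlopeAt g (fun y => f y + f' y) x (a + a') := by
  obtain ⟨b, hb⟩ := h
  obtain ⟨b', hb'⟩ := h'
  refine ⟨b + b', ?_⟩
  filter_upwards [hb, hb'] with y hy hy'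
  rw [hy, hy', inner_add_left]
  ring

theorem HasSlopeAt.const_mul (h : HasSlopeAt g f x a) (c : ℝ) :
    HasSlopeAt g (fun y => c * f y) x (c • a) := by
  obtain ⟨b, hb⟩ := h
  refine ⟨c * b, ?_⟩
  filter_upwards [hb] with y hy
  rw [hy, real_inner_smul_left]
  ring

theorem HasSlopeAt.sub (h : HasSlopeAt g f x a) (h' : HasSlopeAt g f' x a') :
    HasSlopeAt g (fun y => f y - f' y) x (a - a') := by
  obtain ⟨b, hb⟩ := h
  obtain ⟨b', hb'⟩ := h'
  refine ⟨b - b', ?_⟩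
  filter_upwards [hb, hb'] with y hy hy'
  rw [hy, hy', inner_sub_left]
  ring

theorem HasSlopeAt.unique (hg : map g (𝓝 x) = 𝓝 (g x)) (h : HasSlopeAt g f x a)
    (h' : HasSlopeAt g f x a') : a = a' := by
  obtain ⟨b, hb⟩ := h
  obtain ⟨b', hb'⟩ := h'
  refine sub_eq_zero.1 (eq_zero_of_eventually_inner_eq (w := g x) (c := b' - b) ?_)
  rw [← hg, eventually_map]
  filter_upwards [hb, hb'] with y hy hy'
  rw [inner_sub_left]
  linarith

end Affine

section Developing

variable {n : ℕ} {M : Type*} [TopologicalSpace M] [ChartedSpace (E n) M] {ι : Type*}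
  {Ω : Type*} [TopologicalSpace Ω] {π : Ω → M}

/-- The pulled back coordinates are the restriction of a chart of `Ω`. -/
theorem exists_chart_coverCoord (hπ : IsLocalHomeomorph π) (x : Ω) :
    ∃ e : OpenPartialHomeomorph Ω (E n), x ∈ e.source ∧ ∀ y, e y = coverCoord n π x y := by
  obtain ⟨e, hx, rfl⟩ := hπ x
  refine ⟨e.trans (chartAt (E n) (e x)), ?_, fun y => rfl⟩
  simp [hx]

theorem eventually_map_nhds_coverCoord (hπ : IsLocalHomeomorph π) (x : Ω) :
    ∀ᶠ y in 𝓝 x, map (coverCoord n π x) (𝓝 y) = 𝓝 (coverCoord n π x y) := by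
  obtain ⟨e, hx, he⟩ := exists_chart_coverCoord (n := n) hπ x
  have hfun : coverCoord n π x = e := (funext he).symm
  rw [hfun]
  filter_upwards [e.open_source.mem_nhds hx] with y hy
  exact e.map_nhds_eq hy

variable (n π) in
/-- An affine function on `Ω`. -/
def IsAffineFunction (f : Ω → ℝ) : Prop :=
  ∀ x, IsAffineAt (coverCoord n π x) f x

theorem IsAffineFunction.sub {f f' : Ω → ℝ} (h : IsAffineFunction n π f)
    (h' : IsAffineFunction n π f') : IsAffineFunction n π fun y => f y - f' y := fun x => by
  obtain ⟨a, ha⟩ := h x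
  obtain ⟨a', ha'⟩ := h' x
  exact ⟨_, ha.sub ha'⟩

theorem IsAffineFunction.add {f f' : Ω → ℝ} (h : IsAffineFunction n π f)
    (h' : IsAffineFunction n π f') : IsAffineFunction n π fun y => f y + f' y := fun x => by
  obtain ⟨a, ha⟩ := h x
  obtain ⟨a', ha'⟩ := h' x
  exact ⟨_, ha.add ha'⟩

theorem IsAffineFunction.const_mul {f : Ω → ℝ} (h : IsAffineFunction n π f) (c : ℝ) :
    IsAffineFunction n π fun y => c * f y := fun x => by
  obtain ⟨a, ha⟩ := h x
  exact ⟨_, ha.const_mul c⟩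

theorem IsAffineFunction.zero : IsAffineFunction n π fun _ => 0 := fun _ =>
  ⟨0, 0, by simp⟩

theorem IsAffineCoverSection.sub {L : AffineRBundle n M ι} {q q' : Ω → ℝ}
    (h : IsAffineCoverSection L π q) (h' : IsAffineCoverSection L π q') :
    IsAffineFunction n π fun y => q y - q' y := fun x => by
  obtain ⟨a, ha⟩ := h (L.indexAt (π x)) x (L.mem_baseSet_at _)
  obtain ⟨a', ha'⟩ := h' (L.indexAt (π x)) x (L.mem_baseSet_at _)
  refine ⟨a - a', ?_⟩
  have := ha.sub ha'
  simpa only [coverRep, add_sub_add_right_eq_sub] using this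

/-- An affine function which is constant near a point is constant. -/
theorem IsAffineFunction.eq_const [PreconnectedSpace Ω] (hπ : IsLocalHomeomorph π) {f : Ω → ℝ}
    (hf : IsAffineFunction n π f) {x : Ω} {c : ℝ} (hx : ∀ᶠ y in 𝓝 x, f y = c) (y : Ω) :
    f y = c := by
  have hop : IsOpen {y | ∀ᶠ z in 𝓝 y, f z = f y} := by
    rw [isOpen_iff_mem_nhds]
    intro y (hy : ∀ᶠ z in 𝓝 y, f z = f y)
    filter_upwards [hy, eventually_eventually_nhds.2 hy] with z hz hz'
    filter_upwards [hz'] with w hw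
    rw [hw, hz]
  have hcl : IsClosed {y | ∀ᶠ z in 𝓝 y, f z = f y} := by
    rw [← isOpen_compl_iff, isOpen_iff_mem_nhds]
    intro y hy
    obtain ⟨a, b, hab⟩ := hf y
    filter_upwards [eventually_eventually_nhds.2 hab,
      eventually_map_nhds_coverCoord (n := n) hπ y] with z hz hmap (hz' : ∀ᶠ w in 𝓝 z, f w = f z)
    apply hy
    have ha : a = 0 := by
      refine eq_zero_of_eventually_inner_eq (w := coverCoord n π y z) (c := f z - b) ?_
      rw [← hmap, eventually_map]
      filter_upwards [hz, hz'] with w hw hw'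
      linarith
    subst ha
    have hab' : ∀ᶠ w in 𝓝 y, f w = b := by simpa using hab
    filter_upwards [hab'] with w hw
    rw [hw, hab'.self_of_nhds]
  have huniv := IsClopen.eq_univ (s := {y | ∀ᶠ z in 𝓝 y, f z = f y}) ⟨hcl, hop⟩ ⟨x, show ∀ᶠ z in 𝓝 x, f z = f x by
    filter_upwards [hx] with z hz
    rw [hz, hx.self_of_nhds]⟩
  have hloc : IsLocallyConstant f := (IsLocallyConstant.iff_eventually_eq f).2 fun y =>
    huniv.symm.subset (mem_univ y)
  rw [hloc.apply_eq_of_preconnectedSpace y x, hx.self_of_nhds]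

variable (n π) in
/-- `D : Ω → ℝⁿ` is a developing map, all of whose components span, together with the constants,
the space of affine functions. -/
structure IsDevelopingMap (D : Ω → E n) : Prop where
  local_coord : ∀ x, ∃ (A : E n ≃L[ℝ] E n) (b : E n), ∀ᶠ y in 𝓝 x, D y = A (coverCoord n π x y) + b
  affine_eq : ∀ f, IsAffineFunction n π f → ∃ (a : E n) (b : ℝ), ∀ y, f y = inner ℝ a (D y) + b

theorem hasSlopeAt_inner {D : Ω → E n} {x : Ω} {A : E n →L[ℝ] E n} {b : E n}
    (h : ∀ᶠ y in 𝓝 x, D y = A (coverCoord n π x y) + b) (a : E n) :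
    HasSlopeAt (coverCoord n π x) (fun y => inner ℝ a (D y)) x (ContinuousLinearMap.adjoint A a) := by
  refine ⟨inner ℝ a b, ?_⟩
  filter_upwards [h] with y hy
  rw [hy, inner_add_right, ContinuousLinearMap.adjoint_inner_left]

/-- A developing map exists as soon as all slopes at some point are slopes of global affine
functions. -/
theorem exists_isDevelopingMap [PreconnectedSpace Ω] (hπ : IsLocalHomeomorph π) (x₀ : Ω)
    (h : ∀ a : E n, ∃ f, IsAffineFunction n π f ∧ HasSlopeAt (coverCoord n π x₀) f x₀ a) :
    ∃ D : Ω → E n, IsDevelopingMap n π D := by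
  choose f hf hfs using fun i : Fin n => h (EuclideanSpace.single i 1)
  set D : Ω → E n := fun y => WithLp.toLp 2 fun i => f i y with hD
  have hinner : ∀ a y, inner ℝ a (D y) = ∑ i, a i * f i y := fun a y => by
    simp [hD, PiLp.inner_apply, mul_comm]
  have hDaff : ∀ a, IsAffineFunction n π fun y => inner ℝ a (D y) := by
    intro a
    simp only [hinner]
    have : ∀ s : Finset (Fin n), IsAffineFunction n π fun y => ∑ i ∈ s, a i * f i y := by
      intro s
      induction s using Finset.cons_induction with
      | empty => simpa using IsAffineFunction.zero
      | cons i s hi ih =>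
        simp only [Finset.sum_cons]
        exact ((hf i).const_mul _).add ih
    exact this _
  choose b₀ hb₀ using hfs
  have hD0 : ∀ᶠ y in 𝓝 x₀, D y = coverCoord n π x₀ y + WithLp.toLp 2 b₀ := by
    filter_upwards [eventually_all.2 hb₀] with y hy
    ext i
    simp [hD, hy, EuclideanSpace.inner_single_left]
  have hmap0 := (eventually_map_nhds_coverCoord (n := n) hπ x₀).self_of_nhds
  have hzero : ∀ a c, (∀ y, inner ℝ a (D y) = c) → a = 0 := by
    intro a c hac
    refine eq_zero_of_eventually_inner_eq (w := coverCoord n π x₀ x₀)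
      (c := c - inner ℝ a (WithLp.toLp 2 b₀)) ?_
    rw [← hmap0, eventually_map]
    filter_upwards [hD0] with y hy
    rw [← hac y, hy, inner_add_right]
    ring
  refine ⟨D, fun x => ?_, fun F hF => ?_⟩
  · choose a b hab using fun i => hf i x
    let A : E n →ₗ[ℝ] E n :=
      { toFun := fun w => WithLp.toLp 2 fun i => inner ℝ (a i) w
        map_add' := fun v w => by ext i; simp [inner_add_right]
        map_smul' := fun c w => by ext i; simp [real_inner_smul_right] }
    have hDx : ∀ᶠ y in 𝓝 x, D y = A (coverCoord n π x y) + WithLp.toLp 2 b := by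
      filter_upwards [eventually_all.2 hab] with y hy
      ext i
      simp [hD, hy, A]
    have hsurj : Function.Surjective A := by
      rw [← LinearMap.range_eq_top, ← Submodule.orthogonal_eq_bot_iff, Submodule.eq_bot_iff]
      intro α hα
      refine hzero α (inner ℝ α (WithLp.toLp 2 b)) fun y => (hDaff α).eq_const hπ (x := x) ?_ y
      filter_upwards [hDx] with y hy
      rw [hy, inner_add_right, Submodule.inner_left_of_mem_orthogonal (LinearMap.mem_range_self A _)
        hα, zero_add]
    have hinj : Function.Injective A := LinearMap.injective_iff_surjective.2 hsurj
    exact ⟨(LinearEquiv.ofBijective A ⟨hinj, hsurj⟩).toContinuousLinearEquiv, _, hDx⟩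
  · obtain ⟨a, b, hab⟩ := hF x₀
    refine ⟨a, b - inner ℝ a (WithLp.toLp 2 b₀), fun y => ?_⟩
    have := (hF.sub (hDaff a)).eq_const hπ (x := x₀) (c := b - inner ℝ a (WithLp.toLp 2 b₀)) (by
      filter_upwards [hab, hD0] with y hy hy'
      rw [hy, hy', inner_add_right]
      ring) y
    dsimp only at this
    linarith

/-- If the slopes at `x₀` of the elements of `K*` are not Lebesgue null, then all slopes at `x₀` are
slopes of affine functions. -/
theorem exists_affine_of_volume_ne_zero {L : AffineRBundle n M ι} {φ₀ : M → ℝ} {x₀ : Ω}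
    (h : volume (dualCoordSet (univ : Set (MStar L φ₀ π)) x₀) ≠ 0) (a : E n) :
    ∃ f, IsAffineFunction n π f ∧ HasSlopeAt (coverCoord n π x₀) f x₀ a := by
  let S : Submodule ℝ (E n) :=
    { carrier := {a | ∃ f, IsAffineFunction n π f ∧ HasSlopeAt (coverCoord n π x₀) f x₀ a}
      add_mem' := by
        rintro a a' ⟨f, hf, ha⟩ ⟨f', hf', ha'⟩
        exact ⟨_, hf.add hf', ha.add ha'⟩
      zero_mem' := ⟨_, IsAffineFunction.zero, 0, by simp⟩
      smul_mem' := by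
        rintro c a ⟨f, hf, ha⟩
        exact ⟨_, hf.const_mul c, ha.const_mul c⟩ }
  obtain ⟨a₀, q₀, -, ha₀⟩ := nonempty_of_measure_ne_zero h
  have hsub : dualCoordSet (univ : Set (MStar L φ₀ π)) x₀ ⊆ AffineSubspace.mk' a₀ S := by
    rintro a ⟨q, -, ha⟩
    rw [SetLike.mem_coe, AffineSubspace.mem_mk']
    refine ⟨fun y => q.1 y - q₀.1 y, q.2.1.sub q₀.2.1, ?_⟩
    simpa only [coverRep, add_sub_add_right_eq_sub, vsub_eq_sub] using ha.sub ha₀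
  have htop : AffineSubspace.mk' a₀ S = ⊤ := by
    by_contra hne
    exact h (measure_mono_null hsub (Measure.addHaar_affineSubspace volume _ hne))
  have hS : S = ⊤ := by
    rw [← AffineSubspace.direction_mk' a₀ S, htop, AffineSubspace.direction_top]
  exact hS.symm.le (Submodule.mem_top : a ∈ ⊤)

theorem IsDevelopingMap.exists_chart {D : Ω → E n} (hD : IsDevelopingMap n π D)
    (hπ : IsLocalHomeomorph π) (x : Ω) :
    ∃ e : OpenPartialHomeomorph Ω (E n), x ∈ e.source ∧ EqOn D e e.source := by
  obtain ⟨e, hx, he⟩ := exists_chart_coverCoord (n := n) hπ x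
  obtain ⟨A, b, hAb⟩ := hD.local_coord x
  obtain ⟨W, hW, hWo, hxW⟩ := eventually_nhds_iff.1 hAb
  let e' := (e.trans (A.toHomeomorph.trans (Homeomorph.addRight b)).toOpenPartialHomeomorph)
  refine ⟨e'.restrOpen W hWo, ?_, fun y hy => ?_⟩
  · simp [e', hx, hxW]
  · have hy' : y ∈ W := by
      rw [OpenPartialHomeomorph.restrOpen_source] at hy
      exact hy.2
    rw [hW y hy', ← he y]
    rfl

theorem IsDevelopingMap.isLocalHomeomorph {D : Ω → E n} (hD : IsDevelopingMap n π D)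
    (hπ : IsLocalHomeomorph π) : IsLocalHomeomorph D :=
  IsLocalHomeomorph.mk D (hD.exists_chart hπ)

end Developing

/-! ### Convexity of the image of a developing map -/

section Segments

variable {V : Type*} [NormedAddCommGroup V] {Ω : Type*} [TopologicalSpace Ω]
  {D : Ω → V} {x y z : Ω} {r : ℝ} {s s' : V → Ω}

/-- `s` is a continuous section of `D` over the ball of radius `r` around `D z`, through `z`. -/
structure IsSectionAt (D : Ω → V) (r : ℝ) (z : Ω) (s : V → Ω) : Prop where
  continuousOn : ContinuousOn s (Metric.ball (D z) r)
  apply_self : s (D z) = z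
  right_inv : ∀ w ∈ Metric.ball (D z) r, D (s w) = w

theorem exists_isSectionAt (hD : IsLocalHomeomorph D) {C : Set Ω} (hC : IsCompact C) :
    ∃ r > 0, ∀ z ∈ C, ∃ s, IsSectionAt D r z s := by
  have hloc : ∀ z : Ω, ∃ r > 0, ∃ W ∈ 𝓝 z, ∀ z' ∈ W, ∃ s, IsSectionAt D r z' s := by
    intro z
    obtain ⟨e, hz, rfl⟩ := hD z
    obtain ⟨r, hr, hball⟩ := Metric.isOpen_iff.1 e.open_target _ (e.map_source hz)
    refine ⟨r / 2, half_pos hr, e.source ∩ e ⁻¹' Metric.ball (e z) (r / 2), ?_, ?_⟩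
    · exact inter_mem (e.open_source.mem_nhds hz)
        ((e.continuousAt hz).preimage_mem_nhds (Metric.ball_mem_nhds _ (half_pos hr)))
    · rintro z' ⟨hz', hz'b⟩
      have hsub : Metric.ball (e z') (r / 2) ⊆ e.target := fun w hw => hball (by
        have h1 := Metric.mem_ball.1 hw
        have h2 := Metric.mem_ball.1 hz'b
        have h3 := dist_triangle w (e z') (e z)
        exact Metric.mem_ball.2 (by linarith))
      exact ⟨e.symm, e.continuousOn_symm.mono hsub, e.left_inv hz', fun w hw =>
        e.right_inv (hsub hw)⟩
  choose r hr W hW hs using hloc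
  obtain ⟨t, -, htC⟩ := hC.elim_nhds_subcover W fun z _ => hW z
  rcases t.eq_empty_or_nonempty with rfl | hne
  · refine ⟨1, one_pos, fun z hz => ?_⟩
    simpa using htC hz
  · refine ⟨t.inf' hne r, (Finset.lt_inf'_iff hne).2 fun z _ => hr z, fun z hz => ?_⟩
    obtain ⟨z', hz't, hz'⟩ := mem_iUnion₂.1 (htC hz)
    obtain ⟨s, h⟩ := hs z' z hz'
    have hsub := Metric.ball_subset_ball (x := D z) (Finset.inf'_le r hz't)
    exact ⟨s, h.continuousOn.mono hsub, h.apply_self, fun w hw => h.right_inv w (hsub hw)⟩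

theorem IsSectionAt.eventually_left_inv (hD : IsLocalHomeomorph D) (hr : 0 < r)
    (hs : IsSectionAt D r z s) : ∀ᶠ z' in 𝓝 z, D z' ∈ Metric.ball (D z) r ∧ s (D z') = z' := by
  obtain ⟨U, hU, hzU, hinj⟩ := hD.isLocallyInjective z
  have hball := Metric.ball_mem_nhds (D z) hr
  have h1 : ∀ᶠ z' in 𝓝 z, D z' ∈ Metric.ball (D z) r :=
    hD.continuous.continuousAt.eventually hball
  have h2 : Tendsto (fun z' => s (D z')) (𝓝 z) (𝓝 z) := by
    have h3 : ContinuousAt s (D z) := hs.continuousOn.continuousAt hball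
    have := h3.comp (f := D) (x := z) hD.continuous.continuousAt
    simpa [ContinuousAt, Function.comp_def, hs.apply_self] using this
  filter_upwards [h1, hU.mem_nhds hzU, h2.eventually (hU.mem_nhds hzU)] with z' hz1 hz2 hz3
  exact ⟨hz1, hinj hz3 hz2 (hs.right_inv _ hz1)⟩

variable [NormedSpace ℝ V]

theorem IsSectionAt.eqOn [T2Space Ω] (hD : IsLocalHomeomorph D) (hs : IsSectionAt D r z s)
    {z' : Ω} (hs' : IsSectionAt D r z' s') {w : V}
    (hw : w ∈ Metric.ball (D z) r ∩ Metric.ball (D z') r) (h : s w = s' w) :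
    EqOn s s' (Metric.ball (D z) r ∩ Metric.ball (D z') r) := by
  refine (T2Space.isSeparatedMap D).eqOn_of_comp_eqOn hD.isLocallyInjective
    ((convex_ball _ _).inter (convex_ball _ _)).isPreconnected
    (hs.continuousOn.mono inter_subset_left) (hs'.continuousOn.mono inter_subset_right)
    (fun v hv => ?_) hw h
  simp only [Function.comp]
  rw [hs.right_inv v hv.1, hs'.right_inv v hv.2]

/-- `c` is a lift under `D` of the segment from `D x` to `D y`, which leads from `x` to `y`. -/
structure IsSegment (D : Ω → V) (x y : Ω) (c : unitInterval → Ω) : Prop where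
  continuous : Continuous c
  source : c 0 = x
  target : c 1 = y
  map_eq : ∀ t : unitInterval, D (c t) = D x + (t : ℝ) • (D y - D x)

/-- The end point of a lifted segment can be moved. -/
theorem IsSegment.move [T2Space Ω] (hD : IsLocalHomeomorph D) (hr : 0 < r) {c : unitInterval → Ω}
    (hc : IsSegment D x y c) {S : unitInterval → V → Ω} (hS : ∀ t, IsSectionAt D r (c t) (S t))
    {w : V} (hw : w ∈ Metric.ball (D y) r) : ∃ c', IsSegment D x (S 1 w) c' := by
  set p : unitInterval → V := fun t => D x + (t : ℝ) • (w - D x) with hp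
  have hpc : Continuous p := by fun_prop
  have hpb : ∀ t, p t ∈ Metric.ball (D (c t)) r := by
    intro t
    have h1 : p t - D (c t) = (t : ℝ) • (w - D y) := by
      rw [hc.map_eq t, hp]
      module
    rw [Metric.mem_ball, dist_eq_norm, h1, norm_smul, Real.norm_of_nonneg t.2.1]
    rw [Metric.mem_ball, dist_eq_norm] at hw
    exact (mul_le_of_le_one_left (norm_nonneg _) t.2.2).trans_lt hw
  have h1b : w ∈ Metric.ball (D (c 1)) r := by rwa [hc.target]
  refine ⟨fun t => S t (p t), ?_, ?_, ?_, ?_⟩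
  · rw [continuous_iff_continuousAt]
    intro t
    have h1 := hc.continuous.continuousAt.eventually ((hS t).eventually_left_inv hD hr)
    have h2 : ∀ᶠ u in 𝓝 t, p u ∈ Metric.ball (D (c t)) r :=
      hpc.continuousAt.eventually (Metric.isOpen_ball.mem_nhds (hpb t))
    have h3 : (fun u => S t (p u)) =ᶠ[𝓝 t] fun u => S u (p u) := by
      filter_upwards [h1, h2] with u hu1 hu2
      refine (hS t).eqOn hD (hS u) (w := D (c u)) ⟨hu1.1, Metric.mem_ball_self hr⟩ ?_ ⟨hu2, hpb u⟩
      rw [hu1.2, (hS u).apply_self]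
    refine ContinuousAt.congr ?_ h3
    exact ContinuousAt.comp (g := S t) (f := p)
      ((hS t).continuousOn.continuousAt (Metric.isOpen_ball.mem_nhds (hpb t))) hpc.continuousAt
  · have : p 0 = D (c 0) := by simp [hp, hc.source]
    rw [this, (hS 0).apply_self, hc.source]
  · simp [hp]
  · intro t
    rw [(hS t).right_inv _ (hpb t), (hS 1).right_inv _ h1b]

theorem isSegment_refl (x : Ω) : IsSegment D x x fun _ => x :=
  ⟨continuous_const, rfl, rfl, fun t => by simp⟩

/-- `Φ` is locally midpoint convex along the curves which are mapped to lines by `D`. -/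
def IsLocallyMidpointConvex (D : Ω → V) (Φ : Ω → ℝ) : Prop :=
  ∀ (c : ℝ → Ω) (t : ℝ) (w v : V), ContinuousAt c t → (∀ᶠ u in 𝓝 t, D (c u) = w + u • v) →
    ∀ᶠ h in 𝓝 (0 : ℝ), 2 * Φ (c t) ≤ Φ (c (t + h)) + Φ (c (t - h))

variable {Φ : Ω → ℝ}

theorem IsSegment.le_chord (hΦ : IsLocallyMidpointConvex D Φ) (hΦc : Continuous Φ)
    {c : unitInterval → Ω} (hc : IsSegment D x y c) (t : unitInterval) :
    Φ (c t) ≤ (1 - t) * Φ x + t * Φ y := by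
  set c' : ℝ → Ω := IccExtend zero_le_one c with hc'
  have hcc : Continuous c' := hc.continuous.Icc_extend'
  have h0 : c' 0 = x := by rw [hc', IccExtend_left]; exact hc.source
  have h1 : c' 1 = y := by rw [hc', IccExtend_right]; exact hc.target
  have ht : c' t = c t := IccExtend_val _ _ _
  have := le_chord_of_local_midpoint (f := Φ ∘ c') (hΦc.comp hcc).continuousOn (fun s hs => by
    refine hΦ c' s (D x) (D y - D x) hcc.continuousAt ?_
    filter_upwards [Icc_mem_nhds hs.1 hs.2] with u hu
    rw [hc', IccExtend_of_mem _ _ hu, hc.map_eq]) t.2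
  simpa only [Function.comp, h0, h1, ht] using this

/-- Any two points are joined by a segment, if there is a coercive locally convex function. -/
theorem exists_isSegment [T2Space Ω] [PreconnectedSpace Ω] (hD : IsLocalHomeomorph D)
    (hΦ : IsLocallyMidpointConvex D Φ) (hΦc : IsCoercive Φ) (x y : Ω) :
    ∃ c, IsSegment D x y c := by
  have hop : IsOpen {y | ∃ c, IsSegment D x y c} := by
    rw [isOpen_iff_mem_nhds]
    rintro y ⟨c, hc⟩
    obtain ⟨r, hr, hs⟩ := exists_isSectionAt hD (isCompact_range hc.continuous)
    choose S hS using fun t => hs (c t) ⟨t, rfl⟩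
    have h1 := (hS 1).eventually_left_inv hD hr
    rw [hc.target] at h1
    filter_upwards [h1] with z hz
    obtain ⟨c', hc'⟩ := hc.move hD hr hS hz.1
    rw [hz.2] at hc'
    exact ⟨c', hc'⟩
  have hcl : IsClosed {y | ∃ c, IsSegment D x y c} := by
    rw [← closure_subset_iff_isClosed]
    intro y hy
    obtain ⟨r, hr, hs⟩ := exists_isSectionAt hD (hΦc.isCompact_le (max (Φ x) (Φ y + 1)))
    obtain ⟨s, hsy⟩ := hs y (show Φ y ≤ max (Φ x) (Φ y + 1) from
      (by linarith : Φ y ≤ Φ y + 1).trans (le_max_right _ _))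
    have h1 := hsy.eventually_left_inv hD hr
    have h2 : ∀ᶠ z in 𝓝 y, Φ z < Φ y + 1 :=
      hΦc.continuous.continuousAt.eventually (Iio_mem_nhds (by linarith))
    obtain ⟨z, ⟨hz1, hz2⟩, c, hc⟩ := mem_closure_iff_nhds.1 hy _ (h1.and h2)
    have hcC : ∀ t, Φ (c t) ≤ max (Φ x) (Φ y + 1) := fun t => by
      have h3 := hc.le_chord hΦ hΦc.continuous t
      have h4 := le_max_left (Φ x) (Φ y + 1)
      have h5 := hz2.le.trans (le_max_right (Φ x) (Φ y + 1))
      nlinarith [t.2.1, t.2.2]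
    choose S hS using fun t => hs (c t) (hcC t)
    have hyz : D y ∈ Metric.ball (D z) r := Metric.mem_ball_comm.1 hz1.1
    obtain ⟨c', hc'⟩ := hc.move hD hr hS hyz
    have h1z : IsSectionAt D r z (S 1) := by
      have := hS 1
      rwa [hc.target] at this
    have : s (D y) = S 1 (D y) := hsy.eqOn hD h1z (w := D z)
      ⟨hz1.1, Metric.mem_ball_self hr⟩ (by rw [hz1.2, h1z.apply_self])
      ⟨Metric.mem_ball_self hr, hyz⟩
    rw [← this, hsy.apply_self] at hc'
    exact ⟨c', hc'⟩
  have := IsClopen.eq_univ (s := {y | ∃ c, IsSegment D x y c}) ⟨hcl, hop⟩ ⟨x, _, isSegment_refl x⟩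
  exact this.symm.subset (mem_univ y)

theorem injective_of_exists_isSegment [T2Space Ω] (hD : IsLocalHomeomorph D)
    (h : ∀ x y, ∃ c, IsSegment D x y c) : Function.Injective D := by
  intro x y hxy
  obtain ⟨c, hc⟩ := h x y
  have := (T2Space.isSeparatedMap D).eq_of_comp_eq hD.isLocallyInjective hc.continuous
    (continuous_const (y := x)) (funext fun t => by
      simp only [Function.comp]
      rw [hc.map_eq t, hxy]
      simp) 0 hc.source
  rw [← hc.target, this]

theorem convex_range_of_exists_isSegment (h : ∀ x y, ∃ c, IsSegment D x y c) :
    Convex ℝ (range D) := by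
  rintro _ ⟨x, rfl⟩ _ ⟨y, rfl⟩ a b ha hb hab
  obtain ⟨c, hc⟩ := h x y
  refine ⟨c ⟨b, hb, by linarith⟩, ?_⟩
  rw [hc.map_eq]
  obtain rfl : a = 1 - b := by linarith
  module

/-- A function which is locally convex along `D` is convex on the image of `D`. -/
theorem convexOn_of_exists_isSegment
    (h : ∀ x y, ∃ c, IsSegment D x y c) (hΦ : IsLocallyMidpointConvex D Φ) (hΦc : Continuous Φ)
    {σ : V → Ω} (hσ : ∀ x, σ (D x) = x) : ConvexOn ℝ (range D) (Φ ∘ σ) := by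
  refine ⟨convex_range_of_exists_isSegment h, ?_⟩
  rintro _ ⟨x, rfl⟩ _ ⟨y, rfl⟩ a b ha hb hab
  obtain ⟨c, hc⟩ := h x y
  have h1 := hc.le_chord hΦ hΦc ⟨b, hb, by linarith⟩
  obtain rfl : a = 1 - b := by linarith
  have h2 : (1 - b) • D x + b • D y = D (c ⟨b, hb, by linarith⟩) := by
    rw [hc.map_eq]
    module
  simp only [Function.comp, h2, hσ, smul_eq_mul]
  exact h1

end Segments

/-! ### Local convexity of a Hessian metric -/

section Metric

variable {n : ℕ} {M : Type*} [TopologicalSpace M] [ChartedSpace (E n) M] {ι : Type*}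
  {Ω : Type*} [TopologicalSpace Ω] {π : Ω → M} {L : AffineRBundle n M ι} {φ₀ : M → ℝ}

theorem IsDevelopingMap.isLocallyMidpointConvex {D : Ω → E n} (hD : IsDevelopingMap n π D)
    (hπ : Continuous π) (hφ₀ : L.IsHessianMetric φ₀) {q : Ω → ℝ}
    (hq : IsAffineCoverSection L π q) :
    IsLocallyMidpointConvex D fun y => φ₀ (π y) - q y := by
  intro c t w v hc hline
  set x := c t with hx
  set e := chartAt (E n) (π x) with he
  obtain ⟨A, b, hAb⟩ := hD.local_coord x
  obtain ⟨a, β, hqa⟩ := hq (L.indexAt (π x)) x (L.mem_baseSet_at _)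
  set F : E n → ℝ := L.rep (L.indexAt (π x)) φ₀ ∘ e.symm with hF
  set v' : E n := A.symm v with hv'
  set z : E n := e (π x) with hz
  have hsrc : ∀ᶠ y in 𝓝 x, π y ∈ e.source :=
    hπ.continuousAt.eventually (e.open_source.mem_nhds (mem_chart_source _ _))
  -- the function and the coordinates along the curve
  have hcoord : ∀ᶠ u in 𝓝 t, e (π (c u)) = z + (u - t) • v' ∧
      φ₀ (π (c u)) - q (c u) = F (e (π (c u))) - (inner ℝ a (e (π (c u))) + β) := by
    have h0 := hline.self_of_nhds
    have h1 := hAb.self_of_nhds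
    filter_upwards [hline, hc.eventually hAb, hc.eventually hqa, hc.eventually hsrc]
      with u h2 h3 h4 h5
    constructor
    · apply A.injective
      rw [map_add, map_smul, hv', A.apply_symm_apply]
      change D x = A z + b at h1
      change D (c u) = A (e (π (c u))) + b at h3
      rw [h2] at h3
      rw [h0] at h1
      have h6 : A z = w + t • v - b := by rw [h1]; abel
      have h7 : A (e (π (c u))) = w + u • v - b := by rw [h3]; abel
      rw [h6, h7]
      module
    · change coverRep L π (L.indexAt (π x)) q (c u) = inner ℝ a (e (π (c u))) + β at h4
      rw [← h4, hF, Function.comp, e.left_inv h5, AffineRBundle.rep, coverRep]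
      ring
  have key : ∀ᶠ h in 𝓝 (0 : ℝ), 2 * F z ≤ F (z + h • v') + F (z - h • v') := by
    by_cases hv0 : v' = 0
    · simp [hv0, two_mul]
    · obtain ⟨h1, h2⟩ := hφ₀ (L.indexAt (π x)) (π x) (L.mem_baseSet_at _)
      exact local_midpoint_of_second_deriv_pos (by exact_mod_cast contDiffAt_infty.1 h1 2)
        (h2 v' hv0)
  have hp : Tendsto (fun h : ℝ => t + h) (𝓝 0) (𝓝 t) :=
    Continuous.tendsto' (by fun_prop) _ _ (by simp)
  have hm : Tendsto (fun h : ℝ => t - h) (𝓝 0) (𝓝 t) :=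
    Continuous.tendsto' (by fun_prop) _ _ (by simp)
  obtain ⟨-, e0⟩ := hcoord.self_of_nhds
  filter_upwards [key, hp.eventually hcoord, hm.eventually hcoord] with h hh ⟨h1, h1'⟩ ⟨h2, h2'⟩
  have hs1 : t + h - t = h := by ring
  have hs2 : t - h - t = -h := by ring
  rw [hs1] at h1
  rw [hs2, neg_smul, ← sub_eq_add_neg] at h2
  rw [h1', h2', e0, h1, h2, ← hx, ← hz, inner_add_right, inner_sub_right]
  linarith

end Metric

/-! ### The covering -/

section Covering

variable {n : ℕ} {M : Type*} [TopologicalSpace M] {Ω : Type*} [TopologicalSpace Ω] {π : Ω → M}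

theorem t2Space_of_isCoveringMap [T2Space M] (hπ : IsCoveringMap π) : T2Space Ω := by
  refine ⟨fun x y hne => ?_⟩
  by_cases h : π x = π y
  · exact hπ.isSeparatedMap x y h hne
  · obtain ⟨u, v, hu, hv, hxu, hyv, hd⟩ := t2_separation h
    exact ⟨π ⁻¹' u, π ⁻¹' v, hu.preimage hπ.continuous, hv.preimage hπ.continuous, hxu, hyv,
      hd.preimage π⟩

theorem surjective_of_isCoveringMap [PathConnectedSpace M] [Nonempty Ω] (hπ : IsCoveringMap π) :
    Function.Surjective π := by
  intro y
  obtain ⟨x₀⟩ := ‹Nonempty Ω›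
  set γ := PathConnectedSpace.somePath (π x₀) y
  have h0 : γ.toContinuousMap 0 = π x₀ := γ.source
  refine ⟨hπ.liftPath γ.toContinuousMap x₀ h0 1, ?_⟩
  exact (congrFun (hπ.liftPath_lifts γ.toContinuousMap x₀ h0) 1).trans γ.target

/-- The deck transformations of a simply connected covering act transitively on the fibres. -/
theorem exists_deck_apply_eq [SimplyConnectedSpace Ω] [LocallyPathConnectedSpace Ω]
    (hπ : IsCoveringMap π) {x y : Ω} (h : π x = π y) : ∃ γ : Deck π, γ.1 x = y := by
  obtain ⟨F, ⟨hF, hFπ⟩, -⟩ := hπ.existsUnique_continuousMap_lifts ⟨π, hπ.continuous⟩ x y h.symm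
  obtain ⟨G, ⟨hG, hGπ⟩, -⟩ := hπ.existsUnique_continuousMap_lifts ⟨π, hπ.continuous⟩ y x h
  have hF' : ∀ z, π (F z) = π z := congrFun hFπ
  have hG' : ∀ z, π (G z) = π z := congrFun hGπ
  have h1 : G ∘ F = id := hπ.eq_of_comp_eq (G.continuous.comp F.continuous) continuous_id
    (funext fun z => by simp [hF', hG']) x (by simp [hF, hG])
  have h2 : F ∘ G = id := hπ.eq_of_comp_eq (F.continuous.comp G.continuous) continuous_id
    (funext fun z => by simp [hF', hG']) y (by simp [hF, hG])
  exact ⟨⟨⟨⟨F, G, congrFun h1, congrFun h2⟩, F.continuous, G.continuous⟩, hF'⟩, hF⟩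

end Covering

/-! ### The global structure of the universal covering -/

section Global

variable {n : ℕ} {M : Type*} [TopologicalSpace M] [ChartedSpace (E n) M] {ι : Type*}
  {Ω : Type*} [TopologicalSpace Ω] {L : AffineRBundle n M ι} {φ₀ : M → ℝ} {π : Ω → M}

/-- The function `Φ_q = π^* φ₀ - q`. -/
def KStar.Phi (q : KStar L φ₀ π) (x : Ω) : ℝ := φ₀ (π x) - q.1 x

theorem KStar.isCoercive_Phi (q : KStar L φ₀ π) : IsCoercive q.Phi :=
  IsCoercive.of_isProperMap q.2.2.2 q.2.2.1

variable (L φ₀ π) in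
/-- `D` is a developing map which embeds `Ω` onto a convex domain, in which all functions `Φ_q`
are convex. -/
structure IsGlobalDevelopingMap (D : Ω → E n) : Prop extends IsDevelopingMap n π D where
  isOpenEmbedding : IsOpenEmbedding D
  exists_segment : ∀ x y, ∃ c, IsSegment D x y c
  midpoint : ∀ q : KStar L φ₀ π, IsLocallyMidpointConvex D q.Phi

theorem exists_isGlobalDevelopingMap [T2Space Ω] [ConnectedSpace Ω] (hπ : IsLocalHomeomorph π)
    (hφ₀ : L.IsHessianMetric φ₀) {x₀ : Ω}
    (h : volume (dualCoordSet (univ : Set (MStar L φ₀ π)) x₀) ≠ 0) :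
    ∃ D : Ω → E n, IsGlobalDevelopingMap L φ₀ π D := by
  obtain ⟨D, hD⟩ := exists_isDevelopingMap hπ x₀ (exists_affine_of_volume_ne_zero h)
  obtain ⟨a, q, -⟩ := nonempty_of_measure_ne_zero h
  have hloc := hD.isLocalHomeomorph hπ
  have hmid : ∀ q : KStar L φ₀ π, IsLocallyMidpointConvex D q.Phi := fun q =>
    hD.isLocallyMidpointConvex hπ.continuous hφ₀ q.2.1
  have hseg := exists_isSegment hloc (hmid q) q.isCoercive_Phi
  exact ⟨D, hD, .of_continuous_injective_isOpenMap hloc.continuous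
    (injective_of_exists_isSegment hloc hseg) hloc.isOpenMap, hseg, hmid⟩

variable {D : Ω → E n}

theorem IsGlobalDevelopingMap.eq_zero_of_inner_eq [Nonempty Ω] (hD : IsGlobalDevelopingMap L φ₀ π D)
    {a : E n} {c : ℝ} (h : ∀ y, inner ℝ a (D y) = c) : a = 0 := by
  obtain ⟨x⟩ := ‹Nonempty Ω›
  refine eq_zero_of_eventually_inner_eq (w := D x) (c := c) ?_
  rw [← hD.isOpenEmbedding.map_nhds_eq, eventually_map]
  exact Eventually.of_forall h

theorem IsGlobalDevelopingMap.exists_eq (hD : IsGlobalDevelopingMap L φ₀ π D)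
    (q q₀ : KStar L φ₀ π) : ∃ ab : E n × ℝ, ∀ y, q.1 y = q₀.1 y + (inner ℝ ab.1 (D y) + ab.2) := by
  obtain ⟨a, b, h⟩ := hD.affine_eq _ (q.2.1.sub q₀.2.1)
  exact ⟨(a, b), fun y => by dsimp only; rw [← h y]; ring⟩

/-- On `K*`, pointwise convergence is locally uniform convergence. -/
theorem IsGlobalDevelopingMap.eventually_abs_sub_le [Nonempty Ω]
    (hD : IsGlobalDevelopingMap L φ₀ π D)
    (q₁ : KStar L φ₀ π) {S : Set Ω} (hS : IsCompact S) {ε : ℝ} (hε : 0 < ε) :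
    ∀ᶠ q in 𝓝 q₁, ∀ y ∈ S, |q.1 y - q₁.1 y| ≤ ε := by
  choose ab hab using fun q => hD.exists_eq q q₁
  let A : E n × ℝ →ₗ[ℝ] (Ω → ℝ) :=
    { toFun := fun p y => inner ℝ p.1 (D y) + p.2
      map_add' := fun p p' => by
        ext y
        simp only [Prod.fst_add, Prod.snd_add, inner_add_left, Pi.add_apply]
        ring
      map_smul' := fun c p => by
        ext y
        simp [real_inner_smul_left, mul_add] }
  have hker : LinearMap.ker A = ⊥ := by
    rw [LinearMap.ker_eq_bot']
    rintro ⟨a, b⟩ h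
    have h1 : ∀ y, inner ℝ a (D y) = -b := fun y => by
      have : inner ℝ a (D y) + b = 0 := congrFun h y
      linarith
    obtain rfl := hD.eq_zero_of_inner_eq h1
    have h2 := h1 (Classical.arbitrary Ω)
    simp only [inner_zero_left] at h2
    simp only [Prod.mk_eq_zero, true_and]
    linarith
  have hcont : Continuous ab := by
    rw [(LinearMap.isClosedEmbedding_of_injective hker).isInducing.continuous_iff]
    have : A ∘ ab = fun q y => q.1 y - q₁.1 y := by
      ext q y
      have := hab q y
      simp only [Function.comp, A, LinearMap.coe_mk, AddHom.coe_mk]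
      linarith
    rw [this]
    refine continuous_pi fun y => Continuous.sub ?_ continuous_const
    exact (continuous_apply y).comp continuous_subtype_val
  have h0 : ab q₁ = 0 := by
    apply LinearMap.ker_eq_bot.1 hker
    ext y
    have := hab q₁ y
    simp only [map_zero, Pi.zero_apply, A, LinearMap.coe_mk, AddHom.coe_mk]
    linarith
  obtain ⟨C, hC⟩ := (hS.image hD.isOpenEmbedding.continuous).isBounded.exists_norm_le
  have hlim : Tendsto (fun q => ‖(ab q).1‖ * C + |(ab q).2|) (𝓝 q₁) (𝓝 0) := by
    have : Continuous fun q => ‖(ab q).1‖ * C + |(ab q).2| := by fun_prop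
    exact this.tendsto' _ _ (by simp [h0])
  filter_upwards [hlim.eventually (Iio_mem_nhds hε)] with q hq y hy
  rw [hab q y, add_sub_cancel_left]
  refine (abs_add_le _ _).trans (le_trans ?_ (le_of_lt hq))
  gcongr
  exact (abs_real_inner_le_norm _ _).trans
    (mul_le_mul_of_nonneg_left (hC _ ⟨y, hy, rfl⟩) (norm_nonneg _))

/-! ### The Legendre transform -/

/-- The minimum of `Φ_q` for the section `φ₀ + u`: minus the Legendre transform of this section,
at `q`. -/
def minVal (u : M → ℝ) (q : KStar L φ₀ π) : ℝ := ⨅ y, (q.Phi y + u (π y))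

theorem isCoercive_add (hπ : Continuous π) (u : M →ᵇ ℝ) (q : KStar L φ₀ π) :
    IsCoercive fun y => q.Phi y + u (π y) :=
  q.isCoercive_Phi.add_bounded (u.continuous.comp hπ) (B := ‖u‖) fun y => u.norm_coe_le_norm (π y)

theorem minVal_le [Nonempty Ω] (hπ : Continuous π) (u : M →ᵇ ℝ) (q : KStar L φ₀ π) (y : Ω) :
    minVal u q ≤ q.Phi y + u (π y) :=
  (isCoercive_add hπ u q).iInf_le y

theorem minVal_mono [Nonempty Ω] (hπ : Continuous π) {u u' : M →ᵇ ℝ} {c : ℝ}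
    (h : ∀ x, u x ≤ u' x + c) (q : KStar L φ₀ π) : minVal u q ≤ minVal u' q + c := by
  rw [← sub_le_iff_le_add]
  refine le_ciInf fun y => ?_
  have h1 := minVal_le hπ u q y
  have h2 := h (π y)
  linarith

theorem minVal_vadd [Nonempty Ω] (hπ : Continuous π) (u : M →ᵇ ℝ) (c : ℝ) (q : KStar L φ₀ π) :
    minVal u (c +ᵥ q) = minVal u q - c := by
  have hc : ∀ y, (c +ᵥ q : KStar L φ₀ π).Phi y = q.Phi y - c := fun y => by
    change φ₀ (π y) - (q.1 y + c) = φ₀ (π y) - q.1 y - c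
    ring
  apply le_antisymm
  · obtain ⟨y, hy⟩ := (isCoercive_add hπ u q).exists_eq_iInf
    have := minVal_le hπ u (c +ᵥ q) y
    rw [hc] at this
    change _ = minVal u q at hy
    linarith
  · refine le_ciInf fun y => ?_
    have := minVal_le hπ u q y
    rw [hc]
    linarith

theorem minVal_smul (u : M → ℝ) (γ : Deck π) (q : KStar L φ₀ π) :
    minVal u (γ • q) = minVal u q := by
  refine (Equiv.iInf_congr γ.1.toEquiv fun y => ?_).symm
  change φ₀ (π (γ.1 y)) - (γ • q).1 (γ.1 y) + u (π (γ.1 y)) = φ₀ (π y) - q.1 y + u (π y)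
  have h1 : (γ • q).1 (γ.1 y) = q.1 y := congrArg q.1 (γ.1.symm_apply_apply y)
  rw [h1, γ.2 y]

/-- The minimum of `Φ_q` depends continuously on `q`. -/
theorem IsGlobalDevelopingMap.continuous_minVal [Nonempty Ω] (hD : IsGlobalDevelopingMap L φ₀ π D)
    (hπ : Continuous π) (u : M →ᵇ ℝ) : Continuous (minVal u : KStar L φ₀ π → ℝ) := by
  rw [continuous_iff_continuousAt]
  intro q₁
  have hB : ∀ x, |u x| ≤ ‖u‖ := u.norm_coe_le_norm
  obtain ⟨x₁, hx₁⟩ := q₁.isCoercive_Phi.exists_min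
  set m := q₁.Phi x₁ with hm
  set R := m + 3 + 2 * ‖u‖ with hR
  set S := {y | q₁.Phi y ≤ R} with hS
  have hcoS : IsCompact S := q₁.isCoercive_Phi.isCompact_le R
  have hu0 := norm_nonneg u
  have hx₁S : q₁.Phi x₁ ≤ R := by rw [← hm, hR]; linarith
  obtain ⟨y₁, hy₁⟩ := (isCoercive_add hπ u q₁).exists_eq_iInf
  have hy₁' : q₁.Phi y₁ + u (π y₁) = minVal u q₁ := hy₁
  have hle₁ := minVal_le hπ u q₁ x₁
  have hbx := abs_le.1 (hB (π x₁))
  have hby := abs_le.1 (hB (π y₁))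
  have hy₁S : q₁.Phi y₁ ≤ R := by rw [hR]; linarith
  rw [ContinuousAt, Metric.tendsto_nhds]
  intro ε hε
  filter_upwards [hD.eventually_abs_sub_le q₁ hcoS (lt_min one_pos (half_pos hε))] with q hq
  have hclose : ∀ y, q₁.Phi y ≤ R → |q.Phi y - q₁.Phi y| ≤ min 1 (ε / 2) := fun y hy => by
    have h1 : q.Phi y - q₁.Phi y = -(q.1 y - q₁.1 y) := by
      simp only [KStar.Phi]
      ring
    rw [h1, abs_neg]
    exact hq y hy
  have hmin1 := min_le_left 1 (ε / 2)
  have hmin2 := min_le_right 1 (ε / 2)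
  have hout : ∀ y, ¬ q₁.Phi y ≤ R → R - 1 ≤ q.Phi y := by
    intro y hy
    obtain ⟨c, hc⟩ := hD.exists_segment x₁ y
    obtain ⟨t, ht⟩ := mem_range_of_exists_le_of_exists_ge
      (q₁.isCoercive_Phi.continuous.comp hc.continuous) (c := R)
      ⟨0, by simpa only [Function.comp, hc.source] using hx₁S⟩
      ⟨1, by simpa only [Function.comp, hc.target] using (not_le.1 hy).le⟩
    have ht' : q₁.Phi (c t) = R := ht
    have h1 := abs_le.1 (hclose (c t) ht'.le)
    have h2 := abs_le.1 (hclose x₁ hx₁S)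
    have h3 := hc.le_chord (hD.midpoint q) q.isCoercive_Phi.continuous t
    by_contra hlt
    have h4 : q.Phi y < R - 1 := not_le.1 hlt
    have h5 : q.Phi x₁ < R - 1 := by linarith
    have h6 : (1 - (t : ℝ)) * q.Phi x₁ + t * q.Phi y < R - 1 := by
      rcases t.2.1.eq_or_lt with h0 | h0
      · rw [← h0]; linarith
      · nlinarith [t.2.2]
    linarith
  have hup : minVal u q ≤ minVal u q₁ + ε / 2 := by
    have h1 := minVal_le hπ u q y₁
    have h2 := abs_le.1 (hclose y₁ hy₁S)
    linarith
  have hlo : minVal u q₁ - ε / 2 ≤ minVal u q := by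
    refine le_ciInf fun y => ?_
    by_cases hy : q₁.Phi y ≤ R
    · have h1 := minVal_le hπ u q₁ y
      have h2 := abs_le.1 (hclose y hy)
      linarith
    · have h1 := hout y hy
      have h2 := abs_le.1 (hB (π y))
      linarith
  rw [Real.dist_eq, abs_lt]
  constructor <;> linarith

/-- The projection `K* → M*`. -/
def KStar.proj (q : KStar L φ₀ π) : MStar L φ₀ π := toMStar L φ₀ π (toOmegaStar L φ₀ π q)

theorem isQuotientMap_proj : IsQuotientMap (KStar.proj : KStar L φ₀ π → MStar L φ₀ π) :=
  IsQuotientMap.comp (g := toMStar L φ₀ π) (f := toOmegaStar L φ₀ π)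
    isQuotientMap_quotient_mk' isQuotientMap_quotient_mk'

theorem KStar.exists_of_proj_eq {q q' : KStar L φ₀ π} (h : q.proj = q'.proj) :
    ∃ (γ : Deck π) (c : ℝ), q = γ • (c +ᵥ q') := by
  obtain ⟨γ, hγ⟩ : ∃ γ : Deck π, γ • toOmegaStar L φ₀ π q' = toOmegaStar L φ₀ π q :=
    Quotient.exact h
  obtain ⟨c, hc⟩ : ∃ c : ℝ, c +ᵥ (γ • q') = q := Quotient.exact hγ.symm
  exact ⟨γ, c, by rw [smul_vadd_comm, hc]⟩

/-- The Legendre transform of the section `φ₀ + u`, minus the one of `φ₀`, as a function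
on `M*`. -/
def dualPotential (u : M →ᵇ ℝ) (p : MStar L φ₀ π) : ℝ :=
  minVal 0 (isQuotientMap_proj.surjective p).choose -
    minVal u (isQuotientMap_proj.surjective p).choose

theorem dualPotential_proj [Nonempty Ω] (hπ : Continuous π) (u : M →ᵇ ℝ) (q : KStar L φ₀ π) :
    dualPotential u q.proj = minVal 0 q - minVal u q := by
  obtain ⟨γ, c, h⟩ :=
    KStar.exists_of_proj_eq (isQuotientMap_proj.surjective (KStar.proj q)).choose_spec
  have h0 := minVal_vadd hπ (0 : M →ᵇ ℝ) c q
  rw [BoundedContinuousFunction.coe_zero] at h0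
  rw [dualPotential, h, minVal_smul, minVal_smul, minVal_vadd hπ, h0]
  ring

theorem IsGlobalDevelopingMap.continuous_dualPotential [Nonempty Ω]
    (hD : IsGlobalDevelopingMap L φ₀ π D) (hπ : Continuous π) (u : M →ᵇ ℝ) :
    Continuous (dualPotential u : MStar L φ₀ π → ℝ) := by
  rw [isQuotientMap_proj.continuous_iff]
  have : dualPotential u ∘ KStar.proj = fun q : KStar L φ₀ π => minVal 0 q - minVal u q :=
    funext (dualPotential_proj hπ u)
  rw [this]
  exact (hD.continuous_minVal hπ 0).sub (hD.continuous_minVal hπ u)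

theorem dualPotential_anti [Nonempty Ω] (hπ : Continuous π) {u u' : M →ᵇ ℝ} {c : ℝ}
    (h : ∀ x, u x ≤ u' x + c) (p : MStar L φ₀ π) : dualPotential u' p ≤ dualPotential u p + c := by
  obtain ⟨q, rfl⟩ := isQuotientMap_proj.surjective p
  rw [dualPotential_proj hπ, dualPotential_proj hπ]
  linarith [minVal_mono hπ h q]

theorem abs_dualPotential_sub_le [Nonempty Ω] (hπ : Continuous π) (u u' : M →ᵇ ℝ)
    (p : MStar L φ₀ π) : |dualPotential u p - dualPotential u' p| ≤ ‖u - u'‖ := by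
  have h : ∀ x, |u x - u' x| ≤ ‖u - u'‖ := (u - u').norm_coe_le_norm
  have h1 := dualPotential_anti hπ (u := u) (u' := u') (c := ‖u - u'‖)
    (fun x => by linarith [(abs_le.1 (h x)).2]) p
  have h2 := dualPotential_anti hπ (u := u') (u' := u) (c := ‖u - u'‖)
    (fun x => by linarith [(abs_le.1 (h x)).1]) p
  rw [abs_le]
  constructor <;> linarith

theorem dualPotential_zero [Nonempty Ω] (hπ : Continuous π) (p : MStar L φ₀ π) :
    dualPotential 0 p = 0 := by
  obtain ⟨q, rfl⟩ := isQuotientMap_proj.surjective p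
  rw [dualPotential_proj hπ, BoundedContinuousFunction.coe_zero, sub_self]

end Global

/-! ### The inverse of the differential -/

section Inverse

variable {n : ℕ} {M : Type*} [TopologicalSpace M] [ChartedSpace (E n) M] {ι : Type*}
  {Ω : Type*} [TopologicalSpace Ω] {L : AffineRBundle n M ι} {φ₀ : M → ℝ} {π : Ω → M}
  {D : Ω → E n}

theorem mem_differential_iff {u : M → ℝ} {q : KStar L φ₀ π} {x : Ω} :
    toOmegaStar L φ₀ π q ∈ differential (fun y => φ₀ y + u y) x ↔
      ∀ y, q.Phi x + u (π x) ≤ q.Phi y + u (π y) := by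
  constructor
  · rintro ⟨q', hq', h⟩ y
    obtain ⟨c, rfl⟩ : ∃ c : ℝ, c +ᵥ q = q' := Quotient.exact hq'
    have h1 : φ₀ (π x) + u (π x) - (q.1 x + c) ≤ φ₀ (π y) + u (π y) - (q.1 y + c) := h y
    simp only [KStar.Phi]
    linarith
  · intro h
    refine ⟨q, rfl, fun y => ?_⟩
    have h1 := h y
    simp only [KStar.Phi] at h1
    linarith

theorem isInverseAt_of_unique {u : M → ℝ} {q : KStar L φ₀ π} {x : Ω}
    (h : ∀ z, (∀ y, q.Phi z + u (π z) ≤ q.Phi y + u (π y)) ↔ z = x) :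
    IsInverseAt (fun y => φ₀ y + u y) q.proj (π x) :=
  ⟨_, rfl, x, rfl, fun z => mem_differential_iff.trans (h z)⟩

theorem IsInverseAt.exists_unique_min {u : M → ℝ} {p : MStar L φ₀ π} {y₀ : M}
    (h : IsInverseAt (fun y => φ₀ y + u y) p y₀) : ∃ (q : KStar L φ₀ π) (x : Ω), q.proj = p ∧
      π x = y₀ ∧ ∀ z, (∀ y, q.Phi z + u (π z) ≤ q.Phi y + u (π y)) ↔ z = x := by
  obtain ⟨p', rfl, x, rfl, hx⟩ := h
  obtain ⟨q, rfl⟩ : ∃ q, toOmegaStar L φ₀ π q = p' := Quotient.exists_rep p'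
  exact ⟨q, x, rfl, rfl, fun z => mem_differential_iff.symm.trans (hx z)⟩

theorem IsInverseAt.T_eq [Nonempty M] {φ : M → ℝ} {p : MStar L φ₀ π} {y : M}
    (h : IsInverseAt φ p y) : T φ p = y := by
  have hex : ∃ y, IsInverseAt φ p y := ⟨y, h⟩
  rw [T, dif_pos hex]
  exact hex.choose_spec.unique h

/-- The right derivative of the Legendre transform in the direction `v` is `-v ∘ T`. -/
theorem IsInverseAt.tendsto_dualPotential [Nonempty Ω] (hπ : Continuous π) {u : M →ᵇ ℝ}
    (v : M →ᵇ ℝ) {p : MStar L φ₀ π} {y₀ : M} (h : IsInverseAt (fun y => φ₀ y + u y) p y₀) :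
    Tendsto (fun t : ℝ => (dualPotential (u + t • v) p - dualPotential u p) / t) (𝓝[>] 0)
      (𝓝 (-v y₀)) := by
  obtain ⟨q, x, rfl, rfl, hx⟩ := h.exists_unique_min
  have := ((isCoercive_add hπ u q).tendsto_iInf_div hx (v := fun y => v (π y))
    (v.continuous.comp hπ) (B := ‖v‖) fun y => v.norm_coe_le_norm (π y)).neg
  refine this.congr fun t => ?_
  rw [dualPotential_proj hπ, dualPotential_proj hπ]
  have h1 : minVal (u + t • v : M →ᵇ ℝ) q = ⨅ y, (q.Phi y + u (π y) + t * v (π y)) := by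
    simp [minVal, add_assoc]
  have h2 : minVal u q = ⨅ y, (q.Phi y + u (π y)) := rfl
  rw [← h1, ← h2]
  ring

/-- The inverse of the differential of a section is defined almost everywhere. -/
theorem IsGlobalDevelopingMap.ae_isInverseAt [Nonempty Ω] (hD : IsGlobalDevelopingMap L φ₀ π D)
    (hπ : IsLocalHomeomorph π) (q₀ : KStar L φ₀ π) (u : M →ᵇ ℝ) {ν : Measure (MStar L φ₀ π)}
    (hν : IsAbsCont ν) : ∀ᵐ p ∂ν, ∃ y, IsInverseAt (fun y => φ₀ y + u y) p y := by
  rw [ae_iff]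
  refine hν _ fun x => ?_
  obtain ⟨A, b, hAb⟩ := hD.local_coord x
  obtain ⟨s₀, hs₀⟩ := q₀.2.1 (L.indexAt (π x)) x (L.mem_baseSet_at _)
  set B : E n →L[ℝ] E n := ContinuousLinearMap.adjoint (A : E n →L[ℝ] E n)
  have hnull := addHaar_image_eq_zero_of_differentiableOn_of_addHaar_eq_zero volume
    (f := fun a => s₀ + B a) (by fun_prop)
    (volume_nonunique hD.isOpenEmbedding.continuous hD.isOpenEmbedding.injective
      (isCoercive_add hπ.continuous u q₀))
  refine measure_mono_null ?_ hnull
  rintro a ⟨q, hq, ha⟩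
  obtain ⟨⟨α, β⟩, hαβ⟩ := hD.exists_eq q q₀
  have hPhi : ∀ y, q.Phi y = q₀.Phi y - inner ℝ α (D y) - β := fun y => by
    simp only [KStar.Phi, hαβ y]
    ring
  refine ⟨α, ?_, ?_⟩
  · obtain ⟨y, hy⟩ := (isCoercive_add hπ.continuous u q).exists_min
    have hex : ∃ y', y ≠ y' ∧ ∀ z, q.Phi y' + u (π y') ≤ q.Phi z + u (π z) := by
      by_contra! hno
      refine hq ⟨_, isInverseAt_of_unique (x := y) fun z => ⟨fun hz => ?_, ?_⟩⟩
      · by_contra hne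
        obtain ⟨w, hw⟩ := hno z (Ne.symm hne)
        exact absurd (hz w) (not_le.2 hw)
      · rintro rfl
        exact hy
    obtain ⟨y', hne, hy'⟩ := hex
    refine ⟨y, y', hne, fun z => ?_, fun z => ?_⟩
    · have := hy z
      rw [hPhi, hPhi] at this
      linarith
    · have := hy' z
      rw [hPhi, hPhi] at this
      linarith
  · have hmap := (eventually_map_nhds_coverCoord (n := n) hπ x).self_of_nhds
    have h1 := hs₀.add (hasSlopeAt_inner (A := (A : E n →L[ℝ] E n)) hAb α)
    obtain ⟨c, hc⟩ := h1
    refine HasSlopeAt.unique hmap (f := coverRep L π (L.indexAt (π x)) q.1) ⟨c + β, ?_⟩ ha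
    filter_upwards [hc] with y hy
    simp only [coverRep, hαβ y] at hy ⊢
    linarith

theorem IsGlobalDevelopingMap.aemeasurable_T [Nonempty Ω] [CompactSpace M]
    [TopologicalSpace.MetrizableSpace M] [MeasurableSpace M] [BorelSpace M] [Nonempty M]
    (hD : IsGlobalDevelopingMap L φ₀ π D) (hπ : Continuous π) (u : M →ᵇ ℝ)
    {ν : Measure (MStar L φ₀ π)}
    (h : ∀ᵐ p ∂ν, ∃ y, IsInverseAt (fun y => φ₀ y + u y) p y) :
    AEMeasurable (T (fun y => φ₀ y + u y) : MStar L φ₀ π → M) ν := by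
  let : MetricSpace M := TopologicalSpace.metrizableSpaceMetric M
  have hv : ∀ v : M →ᵇ ℝ, AEMeasurable (fun p => v (T (fun y => φ₀ y + u y) p)) ν := by
    intro v
    refine aemeasurable_of_tendsto_metrizable_ae (𝓝[>] (0 : ℝ))
      (f := fun t p => -((dualPotential (u + t • v) p - dualPotential u p) / t)) (fun t => ?_) ?_
    · exact ((((hD.continuous_dualPotential hπ _).sub
        (hD.continuous_dualPotential hπ _)).div_const t).neg).measurable.aemeasurable
    · filter_upwards [h] with p ⟨y, hy⟩
      rw [hy.T_eq]
      simpa using (hy.tendsto_dualPotential hπ v).neg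
  refine NullMeasurable.aemeasurable ?_
  rw [nullMeasurable_iff_eventuallyMeasurable]
  refine @measurable_of_isClosed M _ _ _ _ (eventuallyMeasurableSpace _ (ae ν)) _ fun F hF => ?_
  rcases F.eq_empty_or_nonempty with rfl | hne
  · simp
  · have := (hv (BoundedContinuousFunction.mkOfCompact
      ⟨fun y => Metric.infDist y F, Metric.continuous_infDist_pt F⟩)).nullMeasurable
        (measurableSet_singleton 0)
    have heq : T (fun y => φ₀ y + u y) ⁻¹' F = (fun p : MStar L φ₀ π =>
        Metric.infDist (T (fun y => φ₀ y + u y) p) F) ⁻¹' {0} := by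
      ext p
      simp [hF.mem_iff_infDist_zero hne]
    rw [heq]
    exact this

end Inverse

/-! ### The functional of the right hand side -/

section Functional

variable {M : Type*} [TopologicalSpace M] [MeasurableSpace M] [BorelSpace M]

/-- The primitive of `u ↦ e^{-lu} μ / ∫ e^{-lu} dμ`. -/
def logIntegral (μ : Measure M) (l : ℝ) (u : M →ᵇ ℝ) : ℝ :=
  if l = 0 then ∫ x, u x ∂μ else -(1 / l) * Real.log (∫ x, Real.exp (-l * u x) ∂μ)

variable {μ : Measure M} [IsProbabilityMeasure μ] {l : ℝ}

theorem integrable_exp (μ : Measure M) [IsFiniteMeasure μ] (l : ℝ) (u : M →ᵇ ℝ) :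
    Integrable (fun x => Real.exp (-l * u x)) μ := by
  refine Integrable.of_bound (C := Real.exp (|l| * ‖u‖)) ?_ (Eventually.of_forall fun x => ?_)
  · exact (by fun_prop : Continuous fun x => Real.exp (-l * u x)).measurable.aestronglyMeasurable
  · rw [Real.norm_of_nonneg (Real.exp_pos _).le, Real.exp_le_exp]
    calc -l * u x ≤ |-l * u x| := le_abs_self _
      _ = |l| * |u x| := by rw [abs_mul, abs_neg]
      _ ≤ |l| * ‖u‖ := mul_le_mul_of_nonneg_left (u.norm_coe_le_norm x) (abs_nonneg l)

theorem integral_exp_pos_bcf (μ : Measure M) [IsProbabilityMeasure μ] (l : ℝ) (u : M →ᵇ ℝ) :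
    0 < ∫ x, Real.exp (-l * u x) ∂μ :=
  integral_exp_pos (integrable_exp μ l u)

theorem integrable_bcf (μ : Measure M) [IsFiniteMeasure μ] (u : M →ᵇ ℝ) : Integrable u μ :=
  .of_bound u.continuous.measurable.aestronglyMeasurable ‖u‖
    (Eventually.of_forall fun x => u.norm_coe_le_norm x)

theorem logIntegral_mono {u u' : M →ᵇ ℝ} {c : ℝ} (h : ∀ x, u x ≤ u' x + c) :
    logIntegral μ l u ≤ logIntegral μ l u' + c := by
  have hi := integrable_exp μ l u
  have hi' := (integrable_exp μ l u').const_mul (Real.exp (-l * c))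
  have hp := integral_exp_pos_bcf μ l u
  have hp' := integral_exp_pos_bcf μ l u'
  have hc := Real.exp_pos (-l * c)
  have hlog : Real.log (Real.exp (-l * c) * ∫ x, Real.exp (-l * u' x) ∂μ) =
      -l * c + Real.log (∫ x, Real.exp (-l * u' x) ∂μ) := by
    rw [Real.log_mul hc.ne' hp'.ne', Real.log_exp]
  unfold logIntegral
  split_ifs with hl
  · have h1 := integral_mono (integrable_bcf μ u) ((integrable_bcf μ u').add (integrable_const c)) h
    have h2 : ∫ x, (u' x + c) ∂μ = ∫ x, u' x ∂μ + c := by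
      rw [integral_add (integrable_bcf μ u') (integrable_const c)]
      simp
    exact h1.trans h2.le
  · rcases lt_or_gt_of_ne hl with hneg | hpos
    · have h1 : ∫ x, Real.exp (-l * u x) ∂μ ≤
          Real.exp (-l * c) * ∫ x, Real.exp (-l * u' x) ∂μ := by
        rw [← integral_const_mul]
        refine integral_mono hi hi' fun x => ?_
        simp only [← Real.exp_add, Real.exp_le_exp]
        nlinarith [h x]
      have h2 := Real.log_le_log hp h1
      rw [hlog] at h2
      have h3 : 0 ≤ -(1 / l) := by
        rw [neg_nonneg]
        exact (div_neg_of_pos_of_neg one_pos hneg).le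
      have h4 := mul_le_mul_of_nonneg_left h2 h3
      refine h4.trans_eq ?_
      field_simp
      ring
    · have h1 : Real.exp (-l * c) * ∫ x, Real.exp (-l * u' x) ∂μ ≤
          ∫ x, Real.exp (-l * u x) ∂μ := by
        rw [← integral_const_mul]
        refine integral_mono hi' hi fun x => ?_
        simp only [← Real.exp_add, Real.exp_le_exp]
        nlinarith [h x]
      have h2 := Real.log_le_log (mul_pos hc hp') h1
      rw [hlog] at h2
      have h3 : -(1 / l) ≤ 0 := by
        rw [neg_nonpos]
        positivity
      have h4 := mul_le_mul_of_nonpos_left h2 h3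
      refine h4.trans_eq ?_
      field_simp
      ring

theorem exists_integral_exp_add_const_eq_one (μ : Measure M) [IsProbabilityMeasure μ] (l : ℝ)
    (u : M →ᵇ ℝ) :
    ∃ c : ℝ, ∫ x, Real.exp (-l * (u + BoundedContinuousFunction.const M c) x) ∂μ = 1 := by
  by_cases hl : l = 0
  · exact ⟨0, by simp [hl]⟩
  · have hp := integral_exp_pos_bcf μ l u
    refine ⟨Real.log (∫ x, Real.exp (-l * u x) ∂μ) / l, ?_⟩
    have : ∀ x, Real.exp (-l * (u + BoundedContinuousFunction.const M
        (Real.log (∫ x, Real.exp (-l * u x) ∂μ) / l)) x) =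
        Real.exp (-l * u x) * (∫ x, Real.exp (-l * u x) ∂μ)⁻¹ := fun x => by
      rw [BoundedContinuousFunction.add_apply, BoundedContinuousFunction.const_apply, mul_add,
        Real.exp_add]
      congr 1
      rw [neg_mul, mul_div_cancel₀ _ hl, Real.exp_neg, Real.exp_log hp]
    simp only [this]
    rw [integral_mul_const, mul_inv_cancel₀ hp.ne']

theorem tendsto_logIntegral {u : M →ᵇ ℝ} (hu : ∫ x, Real.exp (-l * u x) ∂μ = 1) (v : M →ᵇ ℝ) :
    Tendsto (fun t : ℝ => (logIntegral μ l (u + t • v) - logIntegral μ l u) / t) (𝓝[>] 0)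
      (𝓝 (∫ x, v x * Real.exp (-l * u x) ∂μ)) := by
  suffices h : HasDerivAt (fun t : ℝ => logIntegral μ l (u + t • v))
      (∫ x, v x * Real.exp (-l * u x) ∂μ) 0 by
    refine h.tendsto_slope_zero_right.congr fun t => ?_
    simp [div_eq_inv_mul]
  by_cases hl : l = 0
  · subst hl
    have h1 : ∀ t : ℝ, logIntegral μ 0 (u + t • v) = ∫ x, u x ∂μ + t * ∫ x, v x ∂μ := fun t => by
      rw [logIntegral, if_pos rfl, ← integral_const_mul,
        ← integral_add (integrable_bcf μ u) ((integrable_bcf μ v).const_mul t)]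
      simp
    simp only [h1]
    have := ((hasDerivAt_id (0 : ℝ)).mul_const (∫ x, v x ∂μ)).const_add (∫ x, u x ∂μ)
    simpa using this
  · set C := |l| * ‖v‖ * Real.exp (|l| * (‖u‖ + ‖v‖)) with hC
    have hder := hasDerivAt_integral_of_dominated_loc_of_deriv_le (μ := μ) (x₀ := (0 : ℝ))
      (s := Metric.ball 0 1) (F := fun t x => Real.exp (-l * (u + t • v : M →ᵇ ℝ) x))
      (F' := fun t x => Real.exp (-l * (u + t • v : M →ᵇ ℝ) x) * (-l * v x)) (bound := fun _ => C)
      (Metric.ball_mem_nhds 0 one_pos)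
      (Eventually.of_forall fun t => (integrable_exp μ l _).aestronglyMeasurable)
      (integrable_exp μ l _) (by
        exact (by fun_prop : Continuous fun x => Real.exp (-l * (u + (0 : ℝ) • v : M →ᵇ ℝ) x) *
          (-l * v x)).measurable.aestronglyMeasurable)
      (Eventually.of_forall fun x t ht => by
        have hb : |(u + t • v : M →ᵇ ℝ) x| ≤ ‖u‖ + ‖v‖ := by
          have h1 : |t| ≤ 1 := by
            have := Metric.mem_ball.1 ht
            rw [Real.dist_eq, sub_zero] at this
            exact this.le
          have h2 := u.norm_coe_le_norm x
          have h3 := v.norm_coe_le_norm x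
          rw [Real.norm_eq_abs] at h2 h3
          calc |(u + t • v : M →ᵇ ℝ) x| ≤ |u x| + |t * v x| := by
                simpa using abs_add_le (u x) (t * v x)
            _ ≤ ‖u‖ + 1 * ‖v‖ := by
              rw [abs_mul]
              gcongr
            _ = ‖u‖ + ‖v‖ := by rw [one_mul]
        rw [norm_mul, Real.norm_of_nonneg (Real.exp_pos _).le, hC, mul_comm]
        gcongr ?_ * Real.exp ?_
        · rw [norm_mul, norm_neg]
          exact mul_le_mul_of_nonneg_left (v.norm_coe_le_norm x) (norm_nonneg l)
        · calc -l * (u + t • v : M →ᵇ ℝ) x ≤ |-l * (u + t • v : M →ᵇ ℝ) x| := le_abs_self _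
            _ = |l| * |(u + t • v : M →ᵇ ℝ) x| := by rw [abs_mul, abs_neg]
            _ ≤ _ := mul_le_mul_of_nonneg_left hb (abs_nonneg l))
      (integrable_const C)
      (Eventually.of_forall fun x t _ => by
        have h1 : HasDerivAt (fun t : ℝ => -l * (u x + t * v x)) (-l * v x) t := by
          have := (((hasDerivAt_id t).mul_const (v x)).const_add (u x)).const_mul (-l)
          simpa using this
        simpa using h1.exp)
    have h0 : ∫ x, Real.exp (-l * (u + (0 : ℝ) • v : M →ᵇ ℝ) x) ∂μ = 1 := by simpa using hu
    have hlog := ((hder.2.log (by rw [h0]; exact one_ne_zero)).const_mul (-(1 / l)))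
    simp only [logIntegral, if_neg hl]
    refine hlog.congr_deriv ?_
    rw [h0, div_one, ← integral_const_mul]
    refine integral_congr_ae (Eventually.of_forall fun x => ?_)
    simp only [zero_smul, add_zero]
    field_simp

end Functional

/-! ### Convex sections -/

section Envelope

variable {n : ℕ} {M : Type*} [TopologicalSpace M] [ChartedSpace (E n) M] {ι : Type*}
  {Ω : Type*} [TopologicalSpace Ω] {L : AffineRBundle n M ι} {φ₀ : M → ℝ} {π : Ω → M}
  {D : Ω → E n} {σ : E n → Ω} {q₀ : KStar L φ₀ π}

/-- The section `φ₀ + u`, read as a function on the image of the developing map `D` with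
inverse `σ`, by means of the affine section `q₀`. -/
def developed (q₀ : KStar L φ₀ π) (σ : E n → Ω) (u : M → ℝ) (z : E n) : ℝ :=
  q₀.Phi (σ z) + u (π (σ z))

theorem IsGlobalDevelopingMap.isConvexSection (hD : IsGlobalDevelopingMap L φ₀ π D)
    (hπ : IsLocalHomeomorph π) (hsurj : Function.Surjective π) (hσ : ∀ x, σ (D x) = x) {u : M → ℝ}
    (hu : ConvexOn ℝ (range D) (developed q₀ σ u)) :
    L.IsConvexSection fun x => φ₀ x + u x := by
  intro i x hx
  obtain ⟨y, rfl⟩ := hsurj x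
  obtain ⟨A, b, hAb⟩ := hD.local_coord y
  obtain ⟨a, β, hq⟩ := q₀.2.1 i y hx
  obtain ⟨s, hys, hs⟩ := hπ y
  set e := chartAt (E n) (π y) with he
  set z₀ := e (π y)
  have hz₀ : z₀ ∈ e.target := mem_chart_target _ _
  have hez : e.symm z₀ = π y := e.left_inv (mem_chart_source _ _)
  have hπs : π y ∈ s.target := by
    rw [hs]
    exact s.map_source hys
  have hsy : s.symm (π y) = y := by
    rw [hs]
    exact s.left_inv hys
  have t1 : Tendsto e.symm (𝓝 z₀) (𝓝 (π y)) := by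
    rw [← hez]
    exact e.continuousAt_symm hz₀
  have t2 : Tendsto s.symm (𝓝 (π y)) (𝓝 y) := by
    have := s.continuousAt_symm hπs
    rwa [ContinuousAt, hsy] at this
  have htarget : ∀ᶠ z in 𝓝 z₀, z ∈ e.target := e.open_target.mem_nhds hz₀
  have hbase : ∀ᶠ m in 𝓝 (π y), m ∈ L.baseSet i := (L.isOpen_baseSet i).mem_nhds hx
  have hstarget : ∀ᶠ m in 𝓝 (π y), m ∈ s.target := s.open_target.mem_nhds hπs
  have hev : ∀ᶠ z in 𝓝 z₀, (z ∈ e.target ∧ e.symm z ∈ L.baseSet i) ∧ e.symm z ∈ s.target ∧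
      D (s.symm (e.symm z)) = A (coverCoord n π y (s.symm (e.symm z))) + b ∧
      coverRep L π i q₀.1 (s.symm (e.symm z)) =
        inner ℝ a (coverCoord n π y (s.symm (e.symm z))) + β :=
    (htarget.and (t1.eventually hbase)).and ((t1.eventually hstarget).and
      (((t2.comp t1).eventually hAb).and ((t2.comp t1).eventually hq)))
  obtain ⟨r, hr, hball⟩ := Metric.eventually_nhds_iff_ball.1 hev
  refine ⟨r, hr, fun z hz => (hball z hz).1, ?_⟩
  have hval : ∀ z ∈ Metric.ball z₀ r, A z + b ∈ range D ∧
      (L.rep i (fun x => φ₀ x + u x) ∘ e.symm) z =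
        developed q₀ σ u (A z + b) + (inner ℝ a z + β) := by
    intro z hz
    obtain ⟨⟨h1, -⟩, h2, h3, h4⟩ := hball z hz
    have hπz : π (s.symm (e.symm z)) = e.symm z := by
      rw [hs]
      exact s.right_inv h2
    have hc : coverCoord n π y (s.symm (e.symm z)) = z := by
      rw [coverCoord, hπz]
      exact e.right_inv h1
    rw [hc] at h3 h4
    refine ⟨⟨_, h3⟩, ?_⟩
    rw [← h3, ← h4, developed, hσ, hπz, coverRep, hπz, KStar.Phi, hπz, Function.comp,
      AffineRBundle.rep]
    ring
  refine ⟨convex_ball _ _, fun z hz z' hz' α γ hα hγ hαγ => ?_⟩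
  obtain ⟨h1, h1'⟩ := hval z hz
  obtain ⟨h2, h2'⟩ := hval z' hz'
  obtain ⟨-, h3'⟩ := hval _ (convex_ball z₀ r hz hz' hα hγ hαγ)
  have h4 := hu.2 h1 h2 hα hγ hαγ
  have h5 : A (α • z + γ • z') + b = α • (A z + b) + γ • (A z' + b) := by
    obtain rfl : α = 1 - γ := by linarith
    rw [map_add, map_smul, map_smul]
    module
  rw [h1', h2', h3', h5, inner_add_right, real_inner_smul_right, real_inner_smul_right]
  simp only [smul_eq_mul] at h4 ⊢
  have h6 : β = α * β + γ * β := by rw [← add_mul, hαγ, one_mul]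
  linarith

theorem IsGlobalDevelopingMap.convexOn_developed_zero (hD : IsGlobalDevelopingMap L φ₀ π D)
    (hσ : ∀ x, σ (D x) = x) : ConvexOn ℝ (range D) (developed q₀ σ 0) := by
  have := convexOn_of_exists_isSegment hD.exists_segment (hD.midpoint q₀)
    q₀.isCoercive_Phi.continuous hσ
  refine this.congr fun z _ => ?_
  simp [developed]

theorem developed_add_const {u : M →ᵇ ℝ} {c : ℝ} {s : Set (E n)}
    (hu : ConvexOn ℝ s (developed q₀ σ u)) :
    ConvexOn ℝ s (developed q₀ σ (u + BoundedContinuousFunction.const M c : M →ᵇ ℝ)) := by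
  refine (hu.add_const c).congr fun z _ => ?_
  simp [developed, add_assoc]

/-- The convex envelope of a section: it has the same Legendre transform. -/
theorem IsGlobalDevelopingMap.exists_envelope [SimplyConnectedSpace Ω] [CompactSpace M]
    (hD : IsGlobalDevelopingMap L φ₀ π D) (hπ : IsCoveringMap π) (hsurj : Function.Surjective π)
    (q₀ : KStar L φ₀ π) (hσ : ∀ x, σ (D x) = x) (u : M →ᵇ ℝ) :
    ∃ w : M →ᵇ ℝ, (∀ x, w x ≤ u x) ∧
      (∀ p : MStar L φ₀ π, dualPotential w p = dualPotential u p) ∧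
      ConvexOn ℝ (range D) (developed q₀ σ w) := by
  have : LocallyPathConnectedSpace Ω := hD.isOpenEmbedding.locallyPathConnectedSpace
  have : Nonempty (KStar L φ₀ π) := ⟨q₀⟩
  have hmin := minVal_le (L := L) (φ₀ := φ₀) hπ.continuous u
  set w₀ : Ω → ℝ := fun y => ⨆ q : KStar L φ₀ π, (minVal u q - q.Phi y) with hw₀
  have hle : ∀ y, ∀ q : KStar L φ₀ π, minVal u q - q.Phi y ≤ u (π y) := fun y q => by
    linarith [hmin q y]
  have hbdd : ∀ y, BddAbove (range fun q : KStar L φ₀ π => minVal u q - q.Phi y) := fun y =>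
    ⟨u (π y), by rintro _ ⟨q, rfl⟩; exact hle y q⟩
  have hw₀le : ∀ y, w₀ y ≤ u (π y) := fun y => ciSup_le (hle y)
  have hlew₀ : ∀ y, ∀ q : KStar L φ₀ π, minVal u q - q.Phi y ≤ w₀ y := fun y q =>
    le_ciSup (hbdd y) q
  have hinv : ∀ x y, π x = π y → w₀ x = w₀ y := by
    intro x y hxy
    obtain ⟨γ, rfl⟩ := exists_deck_apply_eq hπ hxy
    refine Equiv.iSup_congr (MulAction.toPerm γ) fun q => ?_
    rw [MulAction.toPerm_apply, minVal_smul]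
    have h1 : (γ • q).1 (γ.1 x) = q.1 x := congrArg q.1 (γ.1.symm_apply_apply x)
    rw [KStar.Phi, KStar.Phi, h1, γ.2 x]
  have hconv : ConvexOn ℝ (range D) fun z => q₀.Phi (σ z) + w₀ (σ z) := by
    refine ⟨convex_range_of_exists_isSegment hD.exists_segment, ?_⟩
    rintro _ ⟨x, rfl⟩ _ ⟨y, rfl⟩ α β hα hβ hαβ
    obtain ⟨z, hz⟩ := convex_range_of_exists_isSegment hD.exists_segment ⟨x, rfl⟩ ⟨y, rfl⟩
      hα hβ hαβ
    simp only [← hz, hσ, smul_eq_mul]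
    rw [← le_sub_iff_add_le']
    refine ciSup_le fun q => ?_
    obtain ⟨⟨a, b⟩, hab⟩ := hD.exists_eq q q₀
    have hP : ∀ y, q.Phi y = q₀.Phi y - (inner ℝ a (D y) + b) := fun y => by
      simp only [KStar.Phi, hab y]
      ring
    have hx := mul_le_mul_of_nonneg_left (hlew₀ x q) hα
    have hy := mul_le_mul_of_nonneg_left (hlew₀ y q) hβ
    rw [hP] at hx hy ⊢
    rw [hz, inner_add_right, real_inner_smul_right, real_inner_smul_right]
    obtain rfl : α = 1 - β := by linarith
    linarith
  have hw₀c : Continuous w₀ := by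
    have h1 := hconv.continuousOn hD.isOpenEmbedding.isOpen_range
    have h2 := (h1.comp_continuous hD.isOpenEmbedding.continuous fun x => mem_range_self x).sub
      q₀.isCoercive_Phi.continuous
    refine h2.congr fun x => ?_
    simp [hσ]
  set w : M → ℝ := fun x => w₀ (Function.surjInv hsurj x) with hw
  have hwπ : ∀ y, w (π y) = w₀ y := fun y => hinv _ _ (Function.surjInv_eq hsurj _)
  have hwc : Continuous w := by
    rw [(hπ.isQuotientMap hsurj).continuous_iff]
    exact hw₀c.congr fun y => (hwπ y).symm
  have hwu : ∀ x, w x ≤ u x := fun x => by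
    obtain ⟨y, rfl⟩ := hsurj x
    rw [hwπ]
    exact hw₀le y
  refine ⟨BoundedContinuousFunction.mkOfCompact ⟨w, hwc⟩, hwu, fun p => ?_, ?_⟩
  · obtain ⟨q, rfl⟩ := isQuotientMap_proj.surjective p
    rw [dualPotential_proj hπ.continuous, dualPotential_proj hπ.continuous]
    congr 1
    apply le_antisymm
    · simpa using minVal_mono hπ.continuous
        (u := BoundedContinuousFunction.mkOfCompact ⟨w, hwc⟩) (u' := u) (c := 0)
        (fun x => by simpa using hwu x) q
    · refine le_ciInf fun y => ?_
      change minVal u q ≤ q.Phi y + w (π y)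
      rw [hwπ]
      linarith [hlew₀ y q]
  · refine hconv.congr fun z _ => ?_
    change _ = q₀.Phi (σ z) + w (π (σ z))
    rw [hwπ]

/-! ### Compactness of the space of normalized convex sections -/

theorem exists_sublevel_surjective [Nonempty Ω] [CompactSpace M] (hπ : IsOpenMap π)
    (hsurj : Function.Surjective π) (q₀ : KStar L φ₀ π) :
    ∃ R : ℝ, ∀ x : M, ∃ y, q₀.Phi y ≤ R ∧ π y = x := by
  obtain ⟨R, hR⟩ := isCompact_univ.elim_directed_cover
    (fun R : ℝ => π '' {y | q₀.Phi y < R})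
    (fun R => hπ _ (isOpen_lt q₀.isCoercive_Phi.continuous continuous_const))
    (fun x _ => by
      obtain ⟨y, rfl⟩ := hsurj x
      exact mem_iUnion.2 ⟨q₀.Phi y + 1, y, by simp, rfl⟩)
    (Monotone.directed_le fun R R' h => image_mono fun y hy => lt_of_lt_of_le hy h)
  refine ⟨R, fun x => ?_⟩
  obtain ⟨y, hy, rfl⟩ := hR (mem_univ x)
  exact ⟨y, le_of_lt hy, rfl⟩

theorem IsGlobalDevelopingMap.continuousOn_Phi (hD : IsGlobalDevelopingMap L φ₀ π D)
    (hσ : ∀ x, σ (D x) = x) : ContinuousOn (fun z => q₀.Phi (σ z)) (range D) := by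
  have := (hD.convexOn_developed_zero (q₀ := q₀) hσ).continuousOn hD.isOpenEmbedding.isOpen_range
  refine this.congr fun z _ => ?_
  simp [developed]

/-- A Harnack inequality: a convex section which lies below `φ₀` and touches it is bounded. -/
theorem IsGlobalDevelopingMap.exists_bound [Nonempty Ω] [CompactSpace M]
    (hD : IsGlobalDevelopingMap L φ₀ π D) (hπ : IsOpenMap π) (hsurj : Function.Surjective π)
    (q₀ : KStar L φ₀ π) (hσ : ∀ x, σ (D x) = x) :
    ∃ C, ∀ w : M →ᵇ ℝ, (∀ x, w x ≤ 0) → (∃ x, w x = 0) →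
      ConvexOn ℝ (range D) (developed q₀ σ w) → ∀ x, |w x| ≤ C := by
  obtain ⟨R, hR⟩ := exists_sublevel_surjective hπ hsurj q₀
  have hK : IsCompact (D '' {y | q₀.Phi y ≤ R}) :=
    (q₀.isCoercive_Phi.isCompact_le R).image hD.isOpenEmbedding.continuous
  obtain ⟨δ, hδ, hsub⟩ := hK.exists_cthickening_subset_open hD.isOpenEmbedding.isOpen_range
    (image_subset_range _ _)
  obtain ⟨C₀, hC₀⟩ := hK.cthickening (r := δ) |>.exists_bound_of_continuousOn
    ((hD.continuousOn_Phi (q₀ := q₀) hσ).mono hsub)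
  obtain ⟨d, hd⟩ := Metric.isBounded_iff.1 hK.isBounded
  set d' := max d 1 with hd'
  have hd'0 : 0 < d' := one_pos.trans_le (le_max_right _ _)
  set θ := δ / d' with hθ
  have hθ0 : 0 < θ := div_pos hδ hd'0
  refine ⟨C₀ + C₀ * (2 + θ) / θ, fun w hw0 ⟨x₁, hx₁⟩ hconv x => ?_⟩
  obtain ⟨a, ha, rfl⟩ := hR x₁
  obtain ⟨b, hb, rfl⟩ := hR x
  have haK : D a ∈ D '' {y | q₀.Phi y ≤ R} := ⟨a, ha, rfl⟩
  have hbK : D b ∈ D '' {y | q₀.Phi y ≤ R} := ⟨b, hb, rfl⟩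
  set z := D a + θ • (D a - D b) with hz
  have hzth : z ∈ Metric.cthickening δ (D '' {y | q₀.Phi y ≤ R}) := by
    refine Metric.mem_cthickening_of_dist_le z (D a) δ _ haK ?_
    rw [dist_eq_norm, hz, add_sub_cancel_left, norm_smul, Real.norm_of_nonneg hθ0.le, ← dist_eq_norm]
    calc θ * dist (D a) (D b) ≤ θ * d' :=
          mul_le_mul_of_nonneg_left ((hd haK hbK).trans (le_max_left _ _)) hθ0.le
      _ = δ := div_mul_cancel₀ _ hd'0.ne'
  have ha0 := hC₀ _ (Metric.self_subset_cthickening _ haK)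
  have hb0 := hC₀ _ (Metric.self_subset_cthickening _ hbK)
  have hz0 := hC₀ _ hzth
  simp only [hσ, Real.norm_eq_abs] at ha0 hb0 hz0
  obtain ⟨-, hconv⟩ := hconv
  have h1 := hconv (hsub hzth) (mem_range_self b) (show 0 ≤ 1 / (1 + θ) by positivity)
    (show 0 ≤ θ / (1 + θ) by positivity) (by field_simp)
  have h2 : (1 / (1 + θ)) • z + (θ / (1 + θ)) • D b = D a := by
    have h3 : (1 / (1 + θ)) • z + (θ / (1 + θ)) • D b =
        ((1 + θ) / (1 + θ)) • D a := by
      rw [hz]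
      module
    rw [h3, div_self (by positivity), one_smul]
  rw [h2] at h1
  simp only [developed, hσ, hx₁, smul_eq_mul, add_zero] at h1
  have h4 := hw0 (π (σ z))
  have h5 := abs_le.1 ha0
  have h6 := abs_le.1 hb0
  have h7 := abs_le.1 hz0
  have h8 : (1 + θ) * q₀.Phi a ≤ (q₀.Phi (σ z) + w (π (σ z))) + θ * (q₀.Phi b + w (π b)) := by
    have h9 := mul_le_mul_of_nonneg_left h1 (by positivity : 0 ≤ 1 + θ)
    refine h9.trans_eq ?_
    field_simp
  have h10 : -(C₀ * (2 + θ)) ≤ θ * (C₀ + w (π b)) := by nlinarith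
  have h11 : -(C₀ * (2 + θ) / θ) ≤ C₀ + w (π b) := by
    rw [← neg_div, div_le_iff₀ hθ0]
    linarith
  rw [abs_le]
  have hC0 : 0 ≤ C₀ := (abs_nonneg _).trans ha0
  have h12 : 0 ≤ C₀ * (2 + θ) / θ := by positivity
  exact ⟨by linarith, by linarith [hw0 (π b)]⟩

theorem IsGlobalDevelopingMap.equicontinuous (hD : IsGlobalDevelopingMap L φ₀ π D)
    (hπ : IsOpenMap π) (hsurj : Function.Surjective π) (hσ : ∀ x, σ (D x) = x) {C : ℝ}
    {S : Set (M →ᵇ ℝ)} (hC : ∀ w ∈ S, ∀ x, |w x| ≤ C)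
    (hS : ∀ w ∈ S, ConvexOn ℝ (range D) (developed q₀ σ w)) :
    Equicontinuous ((↑) : S → M → ℝ) := by
  intro m
  obtain ⟨x, rfl⟩ := hsurj m
  obtain ⟨r, hr, hball⟩ := Metric.nhds_basis_closedBall.mem_iff.1
    (hD.isOpenEmbedding.isOpen_range.mem_nhds (mem_range_self x))
  obtain ⟨C₀, hC₀⟩ := (isCompact_closedBall (D x) r).exists_bound_of_continuousOn
    ((hD.continuousOn_Phi (q₀ := q₀) hσ).mono hball)
  set K := (2 * (C₀ + C) / (r / 2)).toNNReal with hK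
  have hlip : ∀ w ∈ S, LipschitzOnWith K (developed q₀ σ w) (Metric.ball (D x) (r - r / 2)) := by
    intro w hw
    refine ((hS w hw).subset (Metric.ball_subset_closedBall.trans hball)
      (convex_ball _ _)).lipschitzOnWith_of_abs_le (half_pos hr) fun z hz => ?_
    have h1 := hC₀ z (Metric.mem_closedBall.2 hz.le)
    exact (abs_add_le _ _).trans (add_le_add h1 (hC w hw _))
  rw [Metric.equicontinuousAt_iff_right]
  intro ε hε
  have hDc := hD.isOpenEmbedding.continuous.continuousAt (x := x)
  have e1 : ∀ᶠ y in 𝓝 x, D y ∈ Metric.ball (D x) (r - r / 2) :=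
    hDc.eventually (Metric.ball_mem_nhds _ (by linarith))
  have e2 : ∀ᶠ y in 𝓝 x, K * dist (D x) (D y) < ε / 2 := by
    have : Tendsto (fun y => K * dist (D x) (D y)) (𝓝 x) (𝓝 0) := by
      have hc : Continuous fun y => (K : ℝ) * dist (D x) (D y) :=
        continuous_const.mul (continuous_const.dist hD.isOpenEmbedding.continuous)
      exact hc.tendsto' _ _ (by simp)
    exact this.eventually (Iio_mem_nhds (half_pos hε))
  have e3 : ∀ᶠ y in 𝓝 x, dist (q₀.Phi y) (q₀.Phi x) < ε / 2 :=
    q₀.isCoercive_Phi.continuous.continuousAt.eventually (Metric.ball_mem_nhds _ (half_pos hε))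
  refine Filter.mem_of_superset (hπ.image_mem_nhds (e1.and (e2.and e3))) ?_
  rintro _ ⟨y, ⟨h1, h2, h3⟩, rfl⟩ ⟨w, hw⟩
  have h4 := (hlip w hw).dist_le_mul _ (Metric.mem_ball_self (by linarith)) _ h1
  simp only [developed, hσ, Real.dist_eq] at h3 h4
  have h5 := abs_lt.1 h3
  have h6 := abs_le.1 h4
  change dist (w (π x)) (w (π y)) < ε
  rw [Real.dist_eq, abs_lt]
  constructor <;> linarith

/-- A functional which is continuous, invariant under the addition of constants, and not increased
by the formation of suitable convex envelopes has a convex minimizer. -/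
theorem IsGlobalDevelopingMap.exists_minimizer [Nonempty Ω] [CompactSpace M] [Nonempty M]
    (hD : IsGlobalDevelopingMap L φ₀ π D) (hπ : IsOpenMap π) (hsurj : Function.Surjective π)
    (q₀ : KStar L φ₀ π) (hσ : ∀ x, σ (D x) = x) {J : (M →ᵇ ℝ) → ℝ} (hJ : Continuous J)
    (hJc : ∀ u c, J (u + BoundedContinuousFunction.const M c) = J u)
    (hJe : ∀ u, ∃ w, J w ≤ J u ∧ ConvexOn ℝ (range D) (developed q₀ σ w)) :
    ∃ u : M →ᵇ ℝ, ConvexOn ℝ (range D) (developed q₀ σ u) ∧ ∀ w, J u ≤ J w := by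
  set S : Set (M →ᵇ ℝ) := {w | (∀ x, w x ≤ 0) ∧ (∃ x, w x = 0) ∧
    ConvexOn ℝ (range D) (developed q₀ σ w)} with hS
  obtain ⟨C, hC⟩ := hD.exists_bound hπ hsurj q₀ hσ
  have hC' : ∀ w ∈ S, ∀ x, |w x| ≤ C := fun w hw => hC w hw.1 hw.2.1 hw.2.2
  have hcpt : IsCompact (closure S) := BoundedContinuousFunction.arzela_ascoli (Icc (-C) C)
    isCompact_Icc S (fun w x hw => abs_le.1 (hC' w hw x))
    (hD.equicontinuous hπ hsurj hσ hC' fun w hw => hw.2.2)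
  have h0 : (0 : M →ᵇ ℝ) ∈ S :=
    ⟨fun x => le_rfl, ⟨Classical.arbitrary M, rfl⟩, hD.convexOn_developed_zero hσ⟩
  obtain ⟨u₁, -, hmin⟩ := hcpt.exists_isMinOn ⟨0, subset_closure h0⟩ hJ.continuousOn
  obtain ⟨u, hu, huconv⟩ := hJe u₁
  refine ⟨u, huconv, fun v => hu.trans ?_⟩
  obtain ⟨w, hw, hwconv⟩ := hJe v
  refine le_trans ?_ hw
  obtain ⟨x, -, hx⟩ := isCompact_univ.exists_isMaxOn univ_nonempty w.continuous.continuousOn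
  rw [← hJc w (-w x)]
  refine hmin (subset_closure ⟨fun y => ?_, ⟨x, ?_⟩, developed_add_const hwconv⟩)
  · have h1 : w y ≤ w x := hx (mem_univ y)
    simp only [BoundedContinuousFunction.add_apply, BoundedContinuousFunction.const_apply]
    linarith
  · simp

end Envelope

/-! ### The variational problem -/

section Variational

variable {n : ℕ} {M : Type*} [TopologicalSpace M] [ChartedSpace (E n) M] {ι : Type*}
  {Ω : Type*} [TopologicalSpace Ω] {L : AffineRBundle n M ι} {φ₀ : M → ℝ} {π : Ω → M}
  {D : Ω → E n}

theorem IsGlobalDevelopingMap.integrable_dualPotential [Nonempty Ω]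
    (hD : IsGlobalDevelopingMap L φ₀ π D) (hπ : Continuous π) (ν : Measure (MStar L φ₀ π))
    [IsFiniteMeasure ν] (u : M →ᵇ ℝ) : Integrable (dualPotential u) ν := by
  refine .of_bound (hD.continuous_dualPotential hπ u).measurable.aestronglyMeasurable ‖u‖
    (Eventually.of_forall fun p => ?_)
  simpa [dualPotential_zero hπ] using abs_dualPotential_sub_le hπ u 0 p

theorem IsGlobalDevelopingMap.integral_dualPotential_anti [Nonempty Ω]
    (hD : IsGlobalDevelopingMap L φ₀ π D) (hπ : Continuous π) {ν : Measure (MStar L φ₀ π)}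
    [IsProbabilityMeasure ν] {u u' : M →ᵇ ℝ} {c : ℝ}
    (h : ∀ x, u x ≤ u' x + c) :
    ∫ p, dualPotential u' p ∂ν ≤ ∫ p, dualPotential u p ∂ν + c := by
  have h1 := integral_mono (hD.integrable_dualPotential hπ ν u')
    ((hD.integrable_dualPotential hπ ν u).add (integrable_const c)) (dualPotential_anti hπ h)
  refine h1.trans_eq ?_
  have h2 := integral_add (hD.integrable_dualPotential hπ ν u) (integrable_const (μ := ν) c)
  simpa using h2

variable [MeasurableSpace M] [BorelSpace M]

/-- The Kantorovich type functional, whose critical points are the solutions of the equation. -/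
def energy (ν : Measure (MStar L φ₀ π)) (μ : Measure M) (l : ℝ) (u : M →ᵇ ℝ) : ℝ :=
  ∫ p, dualPotential u p ∂ν + logIntegral μ l u

variable {ν : Measure (MStar L φ₀ π)} [IsProbabilityMeasure ν] {μ : Measure M}
  [IsProbabilityMeasure μ] {l : ℝ}

theorem IsGlobalDevelopingMap.continuous_energy [Nonempty Ω]
    (hD : IsGlobalDevelopingMap L φ₀ π D) (hπ : Continuous π) : Continuous (energy ν μ l) := by
  have key : ∀ u u' : M →ᵇ ℝ, energy ν μ l u - energy ν μ l u' ≤ 2 * ‖u - u'‖ := by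
    intro u u'
    have h : ∀ x, |u x - u' x| ≤ ‖u - u'‖ := (u - u').norm_coe_le_norm
    have h1 := hD.integral_dualPotential_anti (ν := ν) hπ (u := u') (u' := u) (c := ‖u - u'‖)
      fun x => by linarith [(abs_le.1 (h x)).1]
    have h2 := logIntegral_mono (μ := μ) (l := l) (u := u) (u' := u') (c := ‖u - u'‖)
      fun x => by linarith [(abs_le.1 (h x)).2]
    simp only [energy]
    linarith
  refine (LipschitzWith.of_dist_le_mul (K := 2) fun u u' => ?_).continuous
  have h1 := key u u'
  have h2 := key u' u
  rw [norm_sub_rev] at h2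
  rw [Real.dist_eq, dist_eq_norm, abs_le]
  push_cast
  constructor <;> linarith

theorem IsGlobalDevelopingMap.energy_add_const [Nonempty Ω]
    (hD : IsGlobalDevelopingMap L φ₀ π D) (hπ : Continuous π) (u : M →ᵇ ℝ) (c : ℝ) :
    energy ν μ l (u + BoundedContinuousFunction.const M c) = energy ν μ l u := by
  set u' := u + BoundedContinuousFunction.const M c with hu'
  have e1 : ∀ x, u' x ≤ u x + c := fun x => by simp [hu']
  have e2 : ∀ x, u x ≤ u' x + -c := fun x => by simp [hu']
  have h1 := hD.integral_dualPotential_anti (ν := ν) hπ e1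
  have h2 := hD.integral_dualPotential_anti (ν := ν) hπ e2
  have h3 := logIntegral_mono (μ := μ) (l := l) e1
  have h4 := logIntegral_mono (μ := μ) (l := l) e2
  simp only [energy]
  linarith

/-- The Euler–Lagrange inequality for a minimizer of the energy. -/
theorem IsGlobalDevelopingMap.integral_T_le [Nonempty Ω] [Nonempty M]
    (hD : IsGlobalDevelopingMap L φ₀ π D) (hπ : Continuous π) {u : M →ᵇ ℝ}
    (hu : ∀ w, energy ν μ l u ≤ energy ν μ l w) (hu1 : ∫ x, Real.exp (-l * u x) ∂μ = 1)
    (hT : ∀ᵐ p ∂ν, ∃ y, IsInverseAt (fun y => φ₀ y + u y) p y) (v : M →ᵇ ℝ) :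
    ∫ p, v (T (fun y => φ₀ y + u y) p) ∂ν ≤ ∫ x, v x * Real.exp (-l * u x) ∂μ := by
  have hint := hD.integrable_dualPotential hπ ν
  have hlim : Tendsto (fun t : ℝ => ∫ p, (dualPotential (u + t • v) p - dualPotential u p) / t ∂ν)
      (𝓝[>] 0) (𝓝 (∫ p, -v (T (fun y => φ₀ y + u y) p) ∂ν)) := by
    refine tendsto_integral_filter_of_dominated_convergence (fun _ => ‖v‖)
      (Eventually.of_forall fun t => (((hint _).sub (hint _)).div_const t).aestronglyMeasurable)
      ?_ (integrable_const _) ?_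
    · filter_upwards [self_mem_nhdsWithin] with t (ht : 0 < t)
      refine Eventually.of_forall fun p => ?_
      rw [Real.norm_eq_abs, abs_div, abs_of_pos ht, div_le_iff₀ ht]
      refine (abs_dualPotential_sub_le hπ _ _ p).trans_eq ?_
      rw [add_sub_cancel_left, norm_smul, Real.norm_of_nonneg ht.le, mul_comm]
    · filter_upwards [hT] with p ⟨y, hy⟩
      rw [hy.T_eq]
      exact hy.tendsto_dualPotential hπ v
  have hsum := hlim.add (tendsto_logIntegral hu1 v)
  have hnonneg := ge_of_tendsto hsum (b := 0) (by
    filter_upwards [self_mem_nhdsWithin] with t (ht : 0 < t)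
    rw [integral_div, integral_sub (hint _) (hint _), ← add_div]
    refine div_nonneg ?_ ht.le
    have := hu (u + t • v)
    simp only [energy] at this
    linarith)
  rw [integral_neg] at hnonneg
  linarith

/-- A minimizer of the energy solves the Monge–Ampère equation. -/
theorem IsGlobalDevelopingMap.MA_eq [Nonempty Ω] [Nonempty M] [CompactSpace M]
    [TopologicalSpace.MetrizableSpace M] (hD : IsGlobalDevelopingMap L φ₀ π D)
    (hπ : Continuous π) {u : M →ᵇ ℝ}
    (hu : ∀ w, energy ν μ l u ≤ energy ν μ l w) (hu1 : ∫ x, Real.exp (-l * u x) ∂μ = 1)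
    (hT : ∀ᵐ p ∂ν, ∃ y, IsInverseAt (fun y => φ₀ y + u y) p y) :
    MA ν (fun y => φ₀ y + u y) =
      μ.withDensity fun x => ENNReal.ofReal (Real.exp (-l * u x)) := by
  have hmeas := hD.aemeasurable_T hπ u hT
  have hexp : Measurable fun x => Real.exp (-l * u x) :=
    (by fun_prop : Continuous fun x => Real.exp (-l * u x)).measurable
  have : IsFiniteMeasure (ν.map (T fun y => φ₀ y + u y)) := inferInstance
  have : IsFiniteMeasure (μ.withDensity fun x => ENNReal.ofReal (Real.exp (-l * u x))) :=
    isFiniteMeasure_withDensity_ofReal (integrable_exp μ l u).2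
  rw [MA]
  refine ext_of_forall_integral_eq_of_IsFiniteMeasure fun v => ?_
  rw [integral_map hmeas v.continuous.measurable.aestronglyMeasurable,
    integral_withDensity_eq_integral_toReal_smul hexp.ennreal_ofReal
      (Eventually.of_forall fun x => ENNReal.ofReal_lt_top)]
  have h1 := hD.integral_T_le hπ hu hu1 hT v
  have h2 := hD.integral_T_le hπ hu hu1 hT (-v)
  simp only [BoundedContinuousFunction.neg_apply, neg_mul, integral_neg] at h2
  simp only [ENNReal.toReal_ofReal (Real.exp_pos _).le, smul_eq_mul, mul_comm (Real.exp _)]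
  simp only [neg_mul] at h1 ⊢
  linarith

end Variational

end HessianKE

end

open HessianKE in
theorem theorem1p6 {n : ℕ} {M : Type*} [TopologicalSpace M] [T2Space M] [CompactSpace M]
    [ConnectedSpace M] [MeasurableSpace M] [BorelSpace M]
    [ChartedSpace (EuclideanSpace ℝ (Fin n)) M] [IsAffineManifold n M]
    {ι : Type*} (L : AffineRBundle n M ι) (φ₀ : M → ℝ) (hφ₀ : L.IsHessianMetric φ₀)
    {Ω : Type*} [TopologicalSpace Ω] [SimplyConnectedSpace Ω] (π : Ω → M) (hπ : IsCoveringMap π)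
    (ν : Measure (MStar L φ₀ π)) [IsProbabilityMeasure ν] (hν : IsAbsCont ν)
    [ν.IsOpenPosMeasure]
    (μ : Measure M) [IsProbabilityMeasure μ] (l : ℝ) :
    ∃ φ : M → ℝ, L.IsConvexSection φ ∧
      (∀ᵐ p ∂ν, ∃ y, IsInverseAt φ p y) ∧ AEMeasurable (T φ : MStar L φ₀ π → M) ν ∧
      MA ν φ = μ.withDensity fun x => ENNReal.ofReal (Real.exp (-l * (φ x - φ₀ x))) := by
  have : T2Space Ω := t2Space_of_isCoveringMap hπ
  have : LocallyPathConnectedSpace M := ChartedSpace.locallyPathConnectedSpace (E n) M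
  have : PathConnectedSpace M := pathConnectedSpace_iff_connectedSpace.2 inferInstance
  have : SecondCountableTopology M := ChartedSpace.secondCountable_of_sigmaCompact (E n) M
  have : TopologicalSpace.MetrizableSpace M :=
    TopologicalSpace.metrizableSpace_of_t3_secondCountable M
  have hsurj := surjective_of_isCoveringMap hπ
  obtain ⟨x₀, hx₀⟩ : ∃ x₀ : Ω, volume (dualCoordSet (univ : Set (MStar L φ₀ π)) x₀) ≠ 0 := by
    by_contra! h
    exact one_ne_zero (measure_univ.symm.trans (hν univ h))
  obtain ⟨-, q₀, -⟩ := nonempty_of_measure_ne_zero hx₀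
  obtain ⟨D, hD⟩ := exists_isGlobalDevelopingMap hπ.isLocalHomeomorph hφ₀ hx₀
  have hσ := Function.leftInverse_invFun hD.isOpenEmbedding.injective
  obtain ⟨u₀, hu₀, hmin⟩ := hD.exists_minimizer hπ.isOpenMap hsurj q₀ hσ
    (hD.continuous_energy (ν := ν) (μ := μ) (l := l) hπ.continuous)
    (hD.energy_add_const hπ.continuous) fun u => by
      obtain ⟨w, hwu, hw, hconv⟩ := hD.exists_envelope hπ hsurj q₀ hσ u
      refine ⟨w, ?_, hconv⟩
      have h1 := logIntegral_mono (μ := μ) (l := l) (u := w) (u' := u) (c := 0) (by simpa using hwu)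
      simp only [energy, hw]
      linarith
  obtain ⟨c, hc⟩ := exists_integral_exp_add_const_eq_one μ l u₀
  set u := u₀ + BoundedContinuousFunction.const M c
  have hT := hD.ae_isInverseAt hπ.isLocalHomeomorph q₀ u hν
  refine ⟨fun y => φ₀ y + u y,
    hD.isConvexSection hπ.isLocalHomeomorph hsurj hσ (developed_add_const hu₀), hT,
    hD.aemeasurable_T hπ.continuous u hT, ?_⟩
  simp only [add_sub_cancel_left]
  exact hD.MA_eq hπ.continuous
    (fun w => (hD.energy_add_const hπ.continuous u₀ c).trans_le (hmin w)) hc hT
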